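/- Let $k\ge 3$ and let $LW_k(x_1,\dots,x_k)=S_1(x_2,\dots,x_k),\,S_2(x_1,x_3,\dots,x_k),\dots,S_k(x_1,\dots,x_{k-1})$ be the Loomis–Whitney join: the relation $S_j$ ranges over all variables except $x_j$, and the answers are all tuples $(x_1,\dots,x_k)$ whose restrictions belong to all the relations. MPC model. There are $p$ servers; the input, relations over the domain $\{1,\dots,n\}$, is partitioned uniformly but otherwise arbitrarily among them. All servers know $n$, $p$, the relation sizes, a common random seed, and the heavy hitters with their frequencies, i.e. for each relation $S_j$ and each set $U$ of its attributes, the partial tuples over $U$ that occur in more than $|S_j|/p$ tuples of $S_j$. In each round, every server sends to every server a bit string that depends on this common information, its initial data and all that it has received in earlier rounds; local computation is unrestricted. The load is the maximum number of bits received by any server in any round. The result is the union of the servers' outputs after the last round. Claim. For every $k\ge 3$ there is an exponent $c$ such that for every $a\in\mathbb N$ there is a constant $C>0$ with the following property. Let $p\ge 1$, $m\ge p$ and $n$ be integers, and let $M=(k-1)\,m\log_2 n$ be the size in bits of a relation with $m$ tuples of arity $k-1$. Then there is a randomized MPC algorithm with $p$ servers and 2 rounds which, on every input with $|S_1|=\dots=|S_k|=m$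 and every uniform initial partition of it, always outputs exactly the answers to $LW_k$, and whose load is, with probability at least $1-p^{-a}$ over the seed, at most $$C\,(1+\log p)^{c}\cdot\frac{M}{p^{1-1/k}} .$$ In other words, $LW_k$ can be computed in 2 rounds with load $\tilde O(M/p^{1-1/k})$, under any input data distribution. -/

import Mathlib

/-- A full conjunctive query without self-joins, given by its hypergraph: the variables are the
elements of `Fin k` (all of them occur in the head), and there is one relation symbol `S_j` for
each `j : Fin l`, whose atom contains the variables `vars j`. -/
structure ConjunctiveQuery (k l : ℕ) where
  vars : Fin l → Finset (Fin k)

namespace ConjunctiveQuery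

variable {k l : ℕ}

/-- The attributes of the relation `S_j`. -/
abbrev Attr (q : ConjunctiveQuery k l) (j : Fin l) : Type := {i : Fin k // i ∈ q.vars j}

/-- The tuples that may occur in `S_j`, over a domain with `n` elements. -/
abbrev Tuple (q : ConjunctiveQuery k l) (n : ℕ) (j : Fin l) : Type := q.Attr j → Fin n

/-- A tuple labelled with the relation symbol to which it belongs. -/
abbrev Fact (q : ConjunctiveQuery k l) (n : ℕ) : Type := (j : Fin l) × q.Tuple n j

/-- An input: one finite relation for every relation symbol. -/
abbrev Database (q : ConjunctiveQuery k l) (n : ℕ) : Type := (j : Fin l) → Finset (q.Tuple n j)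

/-- The answers to the query `q`, that is, the join of all relations. -/
def answers (q : ConjunctiveQuery k l) {n : ℕ} (D : q.Database n) : Finset (Fin k → Fin n) :=
  Finset.univ.filter fun t => ∀ j, (fun i : q.Attr j => t i.1) ∈ D j

/-- All labelled tuples of a database. -/
def facts (q : ConjunctiveQuery k l) {n : ℕ} (D : q.Database n) : Finset (q.Fact n) :=
  Finset.univ.sigma D

/-- The frequency in `S_j` of the restriction of the tuple `t` to the attributes in `U`: the
number of tuples of `S_j` that agree with `t` on `U`. -/
def frequency (q : ConjunctiveQuery k l) {n : ℕ} (D : q.Database n) (j : Fin l)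
    (U : Finset (q.Attr j)) (t : q.Tuple n j) : ℕ :=
  ((D j).filter fun u => ∀ i ∈ U, u i = t i).card

/-- The type of the statistical information on the input. -/
abbrev Statistics (q : ConjunctiveQuery k l) (n : ℕ) : Type :=
  (j : Fin l) → Finset (q.Attr j) → q.Tuple n j → ℕ

/-- The heavy hitters of the input for `p` servers, with their frequencies: the restriction of `t`
to `U` is a heavy hitter in `S_j` if its frequency in `S_j` exceeds `|S_j| / p`. The frequency is
recorded for heavy hitters only; the value `0` stands for everything else. -/
def heavyHitters (q : ConjunctiveQuery k l) {n : ℕ} (p : ℕ) (D : q.Database n) : q.Statistics n :=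
  fun j U t => if (D j).card < p * q.frequency D j U t then q.frequency D j U t else 0

/-- The Loomis-Whitney join: `k` variables, and for every `j` one relation `S_j` over all variables
except the `j`-th. -/
def loomisWhitney (k : ℕ) : ConjunctiveQuery k k where
  vars j := Finset.univ.erase j

/-- The part of the input that is initially stored at the server `s`, if the fact `f` is stored at
the server `place f`. -/
def fragment (q : ConjunctiveQuery k l) {n p : ℕ} (D : q.Database n) (place : q.Fact n → Fin p)
    (s : Fin p) : Finset (q.Fact n) :=
  (q.facts D).filter fun f => place f = s

/-- The input is uniformly partitioned among the `p` servers (up to rounding). -/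
def IsUniformPartition (q : ConjunctiveQuery k l) {n p : ℕ} (D : q.Database n)
    (place : q.Fact n → Fin p) : Prop :=
  ∀ s, (q.fragment D place s).card ≤ ⌈((q.facts D).card : ℝ) / (p : ℝ)⌉₊

end ConjunctiveQuery

/-- What a server has received: the list of the completed rounds, and for every round the message
(a bit string, possibly empty) that came from each of the `p` servers. -/
abbrev MPCHistory (p : ℕ) : Type := List (Fin p → List Bool)

/-- A randomized algorithm in the massively parallel computation (MPC) model with `p` servers, for
the query `q` over a domain with `n` elements. The random seed (for the choice of hash functions) is
uniformly distributed and known to all servers, as are the statistics on the input. Local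
computation is unrestricted and local data is never lost, so the messages that a server sends in a
round and its output at the end are arbitrary functions of the seed, the statistics, its own name,
the part of the input that it stored initially, and everything received in earlier rounds. -/
structure MPCAlgorithm {k l : ℕ} (q : ConjunctiveQuery k l) (n p : ℕ) where
  Seed : Type
  [seedFintype : Fintype Seed]
  [seedNonempty : Nonempty Seed]
  /-- seed, statistics, sender, initial data of the sender, history of the sender, receiver -/
  send : Seed → q.Statistics n → Fin p → Finset (q.Fact n) → MPCHistory p → Fin p → List Bool
  /-- seed, statistics, server, initial data of the server, history of the server -/
  output : Seed → q.Statistics n → Fin p → Finset (q.Fact n) → MPCHistory p →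
    Finset (Fin k → Fin n)

attribute [instance] MPCAlgorithm.seedFintype MPCAlgorithm.seedNonempty

namespace MPCAlgorithm

variable {k l n p : ℕ} {q : ConjunctiveQuery k l}

/-- What the server `s` has received after the first `i` rounds, on the input `D` partitioned among
the servers by `place`. -/
def history (A : MPCAlgorithm q n p) (ω : A.Seed) (D : q.Database n) (place : q.Fact n → Fin p) :
    ℕ → Fin p → MPCHistory p
  | 0, _ => []
  | i + 1, s => A.history ω D place i s ++
      [fun s' => A.send ω (q.heavyHitters p D) s' (q.fragment D place s')
        (A.history ω D place i s') s]

/-- The number of bits that the server `s` receives during round `i` (counted from `0`). -/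
def received (A : MPCAlgorithm q n p) (ω : A.Seed) (D : q.Database n) (place : q.Fact n → Fin p)
    (i : ℕ) (s : Fin p) : ℕ :=
  ∑ s' : Fin p, (A.send ω (q.heavyHitters p D) s' (q.fragment D place s')
    (A.history ω D place i s') s).length

/-- The maximum load over the first `r` rounds: the maximum number of bits received by any server
during any of these rounds. -/
def maxLoad (A : MPCAlgorithm q n p) (r : ℕ) (ω : A.Seed) (D : q.Database n)
    (place : q.Fact n → Fin p) : ℕ :=
  (Finset.range r).sup fun i => Finset.univ.sup fun s => A.received ω D place i s

/-- The union of the outputs of all servers after `r` rounds. -/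
def result (A : MPCAlgorithm q n p) (r : ℕ) (ω : A.Seed) (D : q.Database n)
    (place : q.Fact n → Fin p) : Finset (Fin k → Fin n) :=
  Finset.univ.biUnion fun s =>
    A.output ω (q.heavyHitters p D) s (q.fragment D place s) (A.history ω D place r s)

/-- The probability, over the random seed, that the maximum load over the first `r` rounds is at
most `L` bits. -/
noncomputable def probLoadLe (A : MPCAlgorithm q n p) (r : ℕ) (L : ℝ) (D : q.Database n)
    (place : q.Fact n → Fin p) : ℝ :=
  (Nat.card {ω : A.Seed // (A.maxLoad r ω D place : ℝ) ≤ L} : ℝ) / (Nat.card A.Seed : ℝ)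

/-- On every input whose relations have `m` tuples each, and for every uniform partition of the
input among the servers, the algorithm outputs exactly the answers to `q` after `r` rounds, whatever
the seed, and with probability at least `1 - δ` its maximum load is at most `L` bits. -/
def ComputesWithLoad (A : MPCAlgorithm q n p) (m r : ℕ) (L δ : ℝ) : Prop :=
  ∀ (D : q.Database n) (place : q.Fact n → Fin p),
    (∀ j, (D j).card = m) → q.IsUniformPartition D place →
      (∀ ω, A.result r ω D place = q.answers D) ∧ 1 - δ ≤ A.probLoadLe r L D place

end MPCAlgorithm

/-- The size in bits of a relation with `m` tuples of arity `a` over a domain with `n` elements. -/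
noncomputable def relationBits (a m n : ℕ) : ℝ := (a : ℝ) * (m : ℝ) * Real.logb 2 (n : ℝ)

/-! Put `g = ⌊p^(1/k)⌋` and `L = m / g^(k-1)`, which is `m / p^(1-1/k)` up to a constant factor. A
pattern of values on `U` is heavy if some relation containing the variables `U` has more than `m /
g^#U` tuples with it. As `g^#U ≤ p`, heaviness can be read off from the statistics.

A tuple without heavy patterns is found in one round by the hypercube algorithm with `g` values per
coordinate. Hashing the coordinates one at a time, with a Chernoff bound at each step, gives cells
of size `L` up to powers of `2 + σ` (`card_cell_le`).

Any other answer has a minimal heavy pattern, on some nonempty `U`. Fix `i ∈ U`. Minimality limits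
the tuples that have a minimal heavy pattern on `U` and restrict into `S_i` to `k * g * m`
(`card_cand_le`), that is, `O(L)` per server because `g^k ≤ p`. In the first round each such
candidate meets, for every `j ≠ i`, its restriction in `S_j` at a hashed server. The successful
comparisons are sent to a server depending on the candidate alone, which intersects them over `j`.

Skew is the remaining danger: many candidates may share one restriction to `S_j`. If `j ∈ U`,
minimality leaves at most `k * g ≤ k * L` of them (`card_minHeavy_fiber_le`). If `j ∉ U`, they are
spread over a number of slots proportional to their frequency in `S_i`, and the `S_j` tuple is
copied to every slot; the bound on candidates keeps the copies at `O(m)` (`card_copies_le`,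
`card_group_le`).

All union bounds range over polynomially many events in `p`, since only patterns of frequency above
`m / p` need attention and at most `p` of them exist per relation and `U`. Hence `σ = O(log p)`
suffices, uniformly in `n`. -/

/-! ### Uniform probability: union bounds, resampling, Chernoff bounds. -/

section UniformProbability

open Classical Finset

/-- The probability of an event under the uniform distribution on a finite type. -/
noncomputable def unifProb {Ω : Type*} [Fintype Ω] (E : Ω → Prop) : ℝ :=
  (#{ω | E ω} : ℝ) / (Fintype.card Ω : ℝ)

theorem unifProb_mono {Ω : Type*} [Fintype Ω] {E F : Ω → Prop} (h : ∀ ω, E ω → F ω) :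
    unifProb E ≤ unifProb F := by
  have h1 : #{ω | E ω} ≤ #{ω | F ω} :=
    Finset.card_le_card (Finset.monotone_filter_right _ fun ω _ => h ω)
  unfold unifProb
  gcongr

theorem unifProb_or_le {Ω : Type*} [Fintype Ω] (E F : Ω → Prop) :
    unifProb (fun ω => E ω ∨ F ω) ≤ unifProb E + unifProb F := by
  have key : ∀ G : Ω → Prop, (∀ ω, G ω ↔ E ω ∨ F ω) → unifProb G ≤ unifProb E + unifProb F := by
    intro G hG
    unfold unifProb
    rw [← add_div]
    have h : #{ω | G ω} ≤ #{ω | E ω} + #{ω | F ω} := by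
      refine le_of_eq_of_le ?_ (Finset.card_union_le _ _)
      congr 1
      ext ω
      simp [hG]
    gcongr
    exact_mod_cast h
  exact key _ fun _ => Iff.rfl

theorem unifProb_exists_le {Ω ι : Type*} [Fintype Ω] (s : Finset ι) (E : ι → Ω → Prop) {δ : ℝ}
    (h : ∀ i ∈ s, unifProb (E i) ≤ δ) :
    unifProb (fun ω => ∃ i ∈ s, E i ω) ≤ #s * δ := by
  induction s using Finset.induction_on with
  | empty => simp [unifProb]
  | insert a s ha ih =>
    refine (unifProb_mono (F := fun ω => E a ω ∨ ∃ i ∈ s, E i ω) (by simp)).trans ?_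
    refine (unifProb_or_le _ _).trans ?_
    rw [Finset.card_insert_of_notMem ha]
    have h1 := h a (by simp)
    have h2 := ih fun i hi => h i (by simp [hi])
    push_cast
    linarith

theorem unifProb_not {Ω : Type*} [Fintype Ω] [Nonempty Ω] (E : Ω → Prop) :
    unifProb (fun ω => ¬ E ω) = 1 - unifProb E := by
  have key : ∀ G : Ω → Prop, (∀ ω, G ω ↔ ¬ E ω) → unifProb G = 1 - unifProb E := by
    intro G hG
    have h : #{ω | G ω} + #{ω | E ω} = Fintype.card Ω := by
      rw [← Finset.card_univ, ← Finset.card_filter_add_card_filter_not (s := univ) E, add_comm]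
      congr 2
      ext ω
      simp [hG]
    unfold unifProb
    have h0 : (Fintype.card Ω : ℝ) ≠ 0 := by simp
    rw [eq_sub_iff_add_eq, ← add_div, div_eq_one_iff_eq h0]
    exact_mod_cast h
  exact key _ fun _ => Iff.rfl

theorem unifProb_equiv {Ω Ω' : Type*} [Fintype Ω] [Fintype Ω'] (e : Ω' ≃ Ω) (E : Ω → Prop) :
    unifProb (fun ω' => E (e ω')) = unifProb E := by
  unfold unifProb
  rw [Fintype.card_congr e]
  congr 2
  exact Finset.card_bij (fun a _ => e a) (by simp) (by simp) fun b hb =>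
    ⟨e.symm b, by simpa using hb, by simp⟩

theorem unifProb_prod_right {α β : Type*} [Fintype α] [Fintype β] {E : α × β → Prop} {δ : ℝ}
    (hδ : 0 ≤ δ) (h : ∀ a, unifProb (fun b => E (a, b)) ≤ δ) : unifProb E ≤ δ := by
  rcases isEmpty_or_nonempty β with hβ | hβ
  · simpa [unifProb] using hδ
  rcases isEmpty_or_nonempty α with hα | hα
  · simpa [unifProb] using hδ
  have hb : (0 : ℝ) < Fintype.card β := by exact_mod_cast Fintype.card_pos
  have ha : (0 : ℝ) < Fintype.card α := by exact_mod_cast Fintype.card_pos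
  unfold unifProb at *
  rw [Fintype.card_prod, div_le_iff₀ (by positivity)]
  have h1 : #{x : α × β | E x} = ∑ a : α, #{b : β | E (a, b)} := by
    simp only [Finset.card_filter, Fintype.sum_prod_type]
  rw [h1]
  push_cast
  calc ∑ a : α, (#{b : β | E (a, b)} : ℝ) ≤ ∑ _a : α, δ * Fintype.card β :=
        Finset.sum_le_sum fun a _ => (div_le_iff₀ hb).1 (h a)
    _ = _ := by simp; ring

theorem unifProb_prod_left {α β : Type*} [Fintype α] [Fintype β] {E : α × β → Prop} {δ : ℝ}
    (hδ : 0 ≤ δ) (h : ∀ b, unifProb (fun a => E (a, b)) ≤ δ) : unifProb E ≤ δ := by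
  rw [← unifProb_equiv (Equiv.prodComm β α)]
  exact unifProb_prod_right hδ h

/-- If an event has probability at most `δ` whenever one coordinate is resampled and the others are
kept, then it has probability at most `δ`. -/
theorem unifProb_pi_update {ι β : Type*} [Fintype ι] [Fintype β] [DecidableEq ι] (i : ι)
    {E : (ι → β) → Prop} {δ : ℝ} (hδ : 0 ≤ δ)
    (h : ∀ f : ι → β, unifProb (fun x => E (Function.update f i x)) ≤ δ) : unifProb E ≤ δ := by
  rw [← unifProb_equiv (Equiv.funSplitAt i β).symm]
  refine unifProb_prod_left hδ fun f => ?_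
  rcases isEmpty_or_nonempty β with hβ | ⟨⟨y⟩⟩
  · simpa [unifProb] using hδ
  refine le_of_eq_of_le ?_ (h ((Equiv.funSplitAt i β).symm (y, f)))
  congr 1
  funext x
  congr 1
  funext j
  by_cases hj : j = i
  · subst hj; simp [Equiv.funSplitAt, Equiv.piSplitAt]
  · simp [Equiv.funSplitAt, Equiv.piSplitAt, hj]

theorem one_add_mul_exp_sub_one_le {q x : ℝ} (hq : 0 ≤ q) (hx0 : 0 ≤ x) (hx1 : x ≤ 1) :
    1 + q * (Real.exp x - 1) ≤ Real.exp (2 * q * x) := by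
  have h := Real.abs_exp_sub_one_sub_id_le (x := x) (by rw [abs_of_nonneg hx0]; exact hx1)
  have h1 : Real.exp x - 1 ≤ 2 * x := by
    have := (abs_le.1 h).2
    nlinarith
  have h2 := Real.add_one_le_exp (2 * q * x)
  nlinarith

/-- Chernoff bound for weights `w` that a random function sends to a prescribed set of values. -/
theorem unifProb_weighted_hash {β γ : Type*} [Fintype β] [DecidableEq β] [Fintype γ] [Nonempty γ]
    (S : Finset γ) {q : ℝ} (hS : (#S : ℝ) ≤ q * Fintype.card γ)
    (w : β → ℝ) {B T : ℝ} (hB : 0 < B) (hw0 : ∀ b, 0 ≤ w b) (hwB : ∀ b, w b ≤ B)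
    (hT : ∑ b, w b ≤ T) (σ : ℝ) :
    unifProb (fun h : β → γ => 2 * q * T + σ * B < ∑ b, if h b ∈ S then w b else 0) ≤
      Real.exp (-σ) := by
  have hγ : (0 : ℝ) < Fintype.card γ := by exact_mod_cast Fintype.card_pos
  have hq : 0 ≤ q := by
    by_contra hq
    have : q * Fintype.card γ < 0 := mul_neg_of_neg_of_pos (not_le.1 hq) hγ
    have h0 : (0 : ℝ) ≤ #S := by positivity
    linarith
  set X : (β → γ) → ℝ := fun h => ∑ b, if h b ∈ S then w b else 0 with hX
  -- Exponential moment at parameter `1 / B`: this scaling puts every exponent in `[0, 1]`, and the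
  -- sum over all functions factors because their values are independent.
  have hsum : ∑ h : β → γ, Real.exp (X h / B) ≤
      (Fintype.card γ : ℝ) ^ Fintype.card β * Real.exp (2 * q * T / B) := by
    have h1 : ∀ h : β → γ, Real.exp (X h / B) =
        ∏ b, Real.exp ((if h b ∈ S then w b else 0) / B) := by
      intro h
      rw [← Real.exp_sum, hX, Finset.sum_div]
    have h2 : ∑ h : β → γ, Real.exp (X h / B) =
        ∏ b, ∑ y : γ, Real.exp ((if y ∈ S then w b else 0) / B) := by
      rw [Finset.prod_univ_sum, Fintype.piFinset_univ]
      exact Finset.sum_congr rfl fun h _ => h1 h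
    have h3 : ∀ b, ∑ y : γ, Real.exp ((if y ∈ S then w b else 0) / B) ≤
        Fintype.card γ * Real.exp (2 * q * (w b / B)) := by
      intro b
      have hx0 : 0 ≤ w b / B := div_nonneg (hw0 b) hB.le
      have hx1 : w b / B ≤ 1 := (div_le_one hB).2 (hwB b)
      have e1 : ∀ y : γ, Real.exp ((if y ∈ S then w b else 0) / B) =
          1 + if y ∈ S then Real.exp (w b / B) - 1 else 0 := by
        intro y; split_ifs <;> simp
      have he : 0 ≤ Real.exp (w b / B) - 1 := by
        have := Real.add_one_le_exp (w b / B); linarith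
      simp only [e1]
      rw [Finset.sum_add_distrib, Finset.sum_ite_mem]
      simp only [Finset.univ_inter, Finset.sum_const, nsmul_eq_mul, mul_one, Finset.card_univ]
      have := one_add_mul_exp_sub_one_le hq hx0 hx1
      calc (Fintype.card γ : ℝ) + #S * (Real.exp (w b / B) - 1)
          ≤ Fintype.card γ + q * Fintype.card γ * (Real.exp (w b / B) - 1) := by gcongr
        _ = Fintype.card γ * (1 + q * (Real.exp (w b / B) - 1)) := by ring
        _ ≤ _ := by gcongr
    rw [h2]
    refine (Finset.prod_le_prod (fun b _ => by positivity) fun b _ => h3 b).trans ?_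
    rw [Finset.prod_mul_distrib, Finset.prod_const, Finset.card_univ, ← Real.exp_sum]
    gcongr
    rw [← Finset.mul_sum, ← Finset.sum_div, mul_div_assoc]
    gcongr
  unfold unifProb
  rw [Fintype.card_fun, div_le_iff₀ (by positivity)]
  -- Markov's inequality for `exp (X / B)`; the factor `exp (2qT / B)` then cancels against the
  -- moment bound.
  have hM : (#{h : β → γ | 2 * q * T + σ * B < X h} : ℝ) * Real.exp ((2 * q * T + σ * B) / B) ≤
      ∑ h : β → γ, Real.exp (X h / B) := by
    rw [← nsmul_eq_mul]
    refine (Finset.card_nsmul_le_sum {h : β → γ | 2 * q * T + σ * B < X h}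
      (fun h => Real.exp (X h / B)) _ fun h hh => ?_).trans
      (Finset.sum_le_sum_of_subset_of_nonneg (Finset.subset_univ _) fun _ _ _ => by positivity)
    have := (Finset.mem_filter.1 hh).2
    exact Real.exp_le_exp.2 (by gcongr)
  have e2 : Real.exp ((2 * q * T + σ * B) / B) = Real.exp (2 * q * T / B) * Real.exp σ := by
    rw [← Real.exp_add]; congr 1; field_simp
  rw [e2] at hM
  have hM' := hM.trans hsum
  have hpos : 0 < Real.exp (2 * q * T / B) := Real.exp_pos _
  have hσ : Real.exp (-σ) * Real.exp σ = 1 := by rw [← Real.exp_add]; simp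
  have h4 : (#{h : β → γ | 2 * q * T + σ * B < X h} : ℝ) * Real.exp σ ≤
      (Fintype.card γ : ℝ) ^ Fintype.card β := by
    refine le_of_mul_le_mul_right ?_ hpos
    linarith
  push_cast
  calc (#{h : β → γ | 2 * q * T + σ * B < X h} : ℝ)
      = Real.exp (-σ) * (#{h : β → γ | 2 * q * T + σ * B < X h} * Real.exp σ) := by
        rw [mul_left_comm, hσ, mul_one]
    _ ≤ _ := by gcongr

/-- Load bound for hashing the elements of `A` by their keys: few elements are sent into `S`, if no
key is shared by more than `B` elements. -/
theorem unifProb_hash {τ β γ : Type*} [Fintype β] [DecidableEq β] [Fintype γ] [Nonempty γ]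
    (A : Finset τ) (key : τ → β) (S : Finset γ) {q : ℝ} (hS : (#S : ℝ) ≤ q * Fintype.card γ)
    {B T : ℝ} (hB : 0 < B)
    (hkey : ∀ b, ∀ A' ⊆ A, (∀ t ∈ A', key t = b) → (#A' : ℝ) ≤ B) (hT : (#A : ℝ) ≤ T) (σ : ℝ) :
    unifProb (fun h : β → γ => ∃ A' ⊆ A, (∀ t ∈ A', h (key t) ∈ S) ∧
      2 * q * T + σ * B < #A') ≤ Real.exp (-σ) := by
  have hkey' : ∀ b, (#{t ∈ A | key t = b} : ℝ) ≤ B := fun b =>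
    hkey b _ (filter_subset _ _) fun t ht => (mem_filter.1 ht).2
  have hsum : ∑ b, (#{t ∈ A | key t = b} : ℝ) ≤ T := by
    refine le_of_eq_of_le ?_ hT
    rw [Finset.card_eq_sum_card_fiberwise (f := key) (t := univ) (by simp)]
    push_cast; rfl
  refine (unifProb_mono fun h hh => ?_).trans
    (unifProb_weighted_hash S hS (fun b => (#{t ∈ A | key t = b} : ℝ)) hB (fun _ => by positivity)
      hkey' hsum σ)
  obtain ⟨A', hA', hh1, hh2⟩ := hh
  have hsub : (#A' : ℝ) ≤ #{t ∈ A | h (key t) ∈ S} := by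
    exact_mod_cast card_le_card fun t ht => mem_filter.2 ⟨hA' ht, hh1 t ht⟩
  refine (hh2.trans_le hsub).trans_eq ?_
  rw [Finset.card_eq_sum_card_fiberwise (f := key) (t := univ) (by simp)]
  push_cast
  refine Finset.sum_congr rfl fun b _ => ?_
  rw [Finset.filter_filter]
  split_ifs with hb
  · congr 2; ext t; simp only [Finset.mem_filter]; constructor
    · rintro ⟨h1, -, h3⟩; exact ⟨h1, h3⟩
    · rintro ⟨h1, rfl⟩; exact ⟨h1, hb, rfl⟩
  · simp only [Nat.cast_eq_zero, Finset.card_eq_zero, Finset.filter_eq_empty_iff]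
    rintro t - ⟨h2, rfl⟩; exact hb h2

end UniformProbability

/-! ### Encoding finite sets as bit strings. -/

section Encoding

open Classical Finset

/-- Finite sets of elements that fit into `b` bits can be written with `b` bits per element. -/
theorem exists_encoding (α : Type) [Fintype α] {b : ℕ} (hb : 1 ≤ b)
    (hα : Fintype.card α ≤ 2 ^ b) :
    ∃ (enc : Finset α → List Bool) (dec : List Bool → Finset α),
      (∀ S, dec (enc S) = S) ∧ ∀ S, (enc S).length = b * #S := by
  -- Each cardinality is encoded separately; as `b ≥ 1`, the length of the string reveals the
  -- cardinality, so no delimiter is needed.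
  have hex : ∀ c : ℕ, Nonempty ({S : Finset α // #S = c} ↪ (Fin (b * c) → Bool)) := by
    intro c
    refine Function.Embedding.nonempty_of_card_le ?_
    rw [Fintype.card_finset_len]
    simp only [Fintype.card_fun, Fintype.card_bool, Fintype.card_fin]
    calc (Fintype.card α).choose c ≤ Fintype.card α ^ c := Nat.choose_le_pow _ _
      _ ≤ (2 ^ b) ^ c := Nat.pow_le_pow_left hα c
      _ = 2 ^ (b * c) := (pow_mul _ _ _).symm
  let e : ∀ c : ℕ, {S : Finset α // #S = c} ↪ (Fin (b * c) → Bool) := fun c => (hex c).some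
  let enc : Finset α → List Bool := fun S => List.ofFn (e #S ⟨S, rfl⟩)
  have hlen : ∀ S, (enc S).length = b * #S := fun S => by simp [enc]
  have hinj : Function.Injective enc := by
    intro S T h
    have hc : #S = #T := by
      have := congrArg List.length h
      rw [hlen, hlen] at this
      exact Nat.eq_of_mul_eq_mul_left hb this
    have key : ∀ (c : ℕ) (hS : #S = c) (hT : #T = c),
        List.ofFn (e c ⟨S, hS⟩) = List.ofFn (e c ⟨T, hT⟩) → S = T := by
      intro c hS hT h
      exact congrArg Subtype.val ((e c).injective (List.ofFn_injective h))
    have h' : ∀ (c : ℕ) (hc : #S = c), enc S = List.ofFn (e c ⟨S, hc⟩) := by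
      rintro c rfl; rfl
    exact key #T hc rfl ((h' _ hc).symm.trans h)
  exact ⟨enc, Function.invFun enc, Function.leftInverse_invFun hinj, hlen⟩

end Encoding

/-! ### From logical two-round schemes to algorithms with bit messages. -/

section TwoRound

open Classical Finset

variable {k l n p : ℕ} {q : ConjunctiveQuery k l}

/-- A two-round algorithm described by its logical content: `route` says which servers receive a
fact in the first round, `forward` which items of type `X` are sent in the second round by a server
that has received a given set of facts. -/
structure TwoRoundScheme (q : ConjunctiveQuery k l) (n p : ℕ) (X : Type) where
  Seed : Type
  [seedFintype : Fintype Seed]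
  [seedNonempty : Nonempty Seed]
  route : Seed → q.Statistics n → q.Fact n → Fin p → Prop
  forward : Seed → q.Statistics n → Fin p → Finset (q.Fact n) → X → Fin p → Prop
  out : Seed → q.Statistics n → Finset (q.Fact n) → Finset X → Finset (Fin k → Fin n)

attribute [instance] TwoRoundScheme.seedFintype TwoRoundScheme.seedNonempty

namespace TwoRoundScheme

variable {X : Type} [Fintype X]

/-- The facts that the server `s` receives in the first round. -/
noncomputable def first (A : TwoRoundScheme q n p X) (ω : A.Seed) (D : q.Database n) (s : Fin p) :
    Finset (q.Fact n) :=
  {f ∈ q.facts D | A.route ω (q.heavyHitters p D) f s}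

/-- The items that the server `s'` sends to the server `s` in the second round. -/
noncomputable def sent (A : TwoRoundScheme q n p X) (ω : A.Seed) (D : q.Database n)
    (s' s : Fin p) : Finset X :=
  {x | A.forward ω (q.heavyHitters p D) s' (A.first ω D s') x s}

/-- First-round routing looks at one fact at a time, so what a server receives in total does not
depend on the initial partition, and each fact is sent to it only once. This reduces the load to
counting facts and items. The equivalence `e` carries probabilities over to the seeds of the scheme.
-/
theorem exists_algorithm [DecidableEq X] (A : TwoRoundScheme q n p X) {b : ℕ} (hb : 1 ≤ b)
    (hF : Fintype.card (q.Fact n) ≤ 2 ^ b) (hX : Fintype.card X ≤ 2 ^ b) :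
    ∃ (M : MPCAlgorithm q n p) (e : M.Seed ≃ A.Seed), ∀ (D : q.Database n) (place : q.Fact n → Fin p)
      (ω : M.Seed),
      M.result 2 ω D place = univ.biUnion (fun s => A.out (e ω) (q.heavyHitters p D)
        (A.first (e ω) D s) (univ.biUnion fun s' => A.sent (e ω) D s' s)) ∧
      ∀ N : ℕ, (∀ s, #(A.first (e ω) D s) ≤ N) → (∀ s, ∑ s', #(A.sent (e ω) D s' s) ≤ N) →
        M.maxLoad 2 ω D place ≤ b * N := by
  obtain ⟨enc1, dec1, hdec1, hlen1⟩ := exists_encoding (q.Fact n) hb hF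
  obtain ⟨enc2, dec2, hdec2, hlen2⟩ := exists_encoding X hb hX
  let snd : A.Seed → q.Statistics n → Fin p → Finset (q.Fact n) → MPCHistory p → Fin p →
      List Bool := fun ω st s' frag hist s =>
    match hist with
    | [] => enc1 {f ∈ frag | A.route ω st f s}
    | r :: _ => enc2 {x | A.forward ω st s' (univ.biUnion fun s'' => dec1 (r s'')) x s}
  let out : A.Seed → q.Statistics n → Fin p → Finset (q.Fact n) → MPCHistory p →
      Finset (Fin k → Fin n) := fun ω st _ _ hist =>
    match hist with
    | [r₁, r₂] => A.out ω st (univ.biUnion fun s' => dec1 (r₁ s'))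
        (univ.biUnion fun s' => dec2 (r₂ s'))
    | _ => ∅
  let M : MPCAlgorithm q n p := ⟨A.Seed, snd, out⟩
  suffices main : ∀ (D : q.Database n) (place : q.Fact n → Fin p) (ω : A.Seed),
      M.result 2 ω D place = univ.biUnion (fun s => A.out ω (q.heavyHitters p D)
        (A.first ω D s) (univ.biUnion fun s' => A.sent ω D s' s)) ∧
      ∀ N : ℕ, (∀ s, #(A.first ω D s) ≤ N) → (∀ s, ∑ s', #(A.sent ω D s' s) ≤ N) →
        M.maxLoad 2 ω D place ≤ b * N from ⟨M, Equiv.refl _, main⟩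
  intro D place ω
  have hfirst : ∀ s, (univ.biUnion fun s' =>
      ({f ∈ q.fragment D place s' | A.route ω (q.heavyHitters p D) f s} : Finset (q.Fact n))) =
      A.first ω D s := by
    intro s
    ext f
    simp [first, ConjunctiveQuery.fragment]
  have hs0 : ∀ s' s, M.send ω (q.heavyHitters p D) s' (q.fragment D place s')
      (M.history ω D place 0 s') s =
      enc1 {f ∈ q.fragment D place s' | A.route ω (q.heavyHitters p D) f s} := fun s' s => rfl
  have hs1 : ∀ s' s, M.send ω (q.heavyHitters p D) s' (q.fragment D place s')
      (M.history ω D place 1 s') s = enc2 (A.sent ω D s' s) := by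
    intro s' s
    have : M.send ω (q.heavyHitters p D) s' (q.fragment D place s')
      (M.history ω D place 1 s') s = enc2 {x | A.forward ω (q.heavyHitters p D) s'
        (univ.biUnion fun s'' => dec1 (enc1
          {f ∈ q.fragment D place s'' | A.route ω (q.heavyHitters p D) f s'})) x s} := rfl
    rw [this]
    simp only [hdec1, hfirst]
    rfl
  refine ⟨?_, fun N h1 h2 => ?_⟩
  · unfold MPCAlgorithm.result
    refine Finset.biUnion_congr rfl fun s _ => ?_
    have : M.output ω (q.heavyHitters p D) s (q.fragment D place s) (M.history ω D place 2 s) =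
      A.out ω (q.heavyHitters p D)
        (univ.biUnion fun s' => dec1 (M.send ω (q.heavyHitters p D) s' (q.fragment D place s')
          (M.history ω D place 0 s') s))
        (univ.biUnion fun s' => dec2 (M.send ω (q.heavyHitters p D) s' (q.fragment D place s')
          (M.history ω D place 1 s') s)) := rfl
    rw [this]
    simp only [hs0, hs1, hdec1, hdec2, hfirst]
  · unfold MPCAlgorithm.maxLoad
    refine Finset.sup_le fun i hi => Finset.sup_le fun s _ => ?_
    have hi2 : i < 2 := Finset.mem_range.1 hi
    unfold MPCAlgorithm.received
    interval_cases i
    · simp only [hs0, hlen1, ← Finset.mul_sum]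
      refine Nat.mul_le_mul_left _ (le_of_eq_of_le ?_ (h1 s))
      rw [← Finset.card_biUnion, hfirst]
      · intro x _ y _ hxy
        rw [Function.onFun, Finset.disjoint_left]
        intro f hf hf'
        simp only [Finset.mem_filter, ConjunctiveQuery.fragment] at hf hf'
        exact hxy (hf.1.2.symm.trans hf'.1.2)
    · simp only [hs1, hlen2, ← Finset.mul_sum]
      exact Nat.mul_le_mul_left _ (h2 s)

end TwoRoundScheme

end TwoRound

/-! ### Patterns, degrees and heaviness for the Loomis–Whitney join. -/

namespace LoomisWhitney

open Classical Finset

variable {k n : ℕ}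

theorem mem_vars {i j : Fin k} : i ∈ (ConjunctiveQuery.loomisWhitney k).vars j ↔ i ≠ j := by
  simp [ConjunctiveQuery.loomisWhitney]

abbrev Tup (k n : ℕ) (j : Fin k) : Type := (ConjunctiveQuery.loomisWhitney k).Tuple n j

abbrev DB (k n : ℕ) : Type := (ConjunctiveQuery.loomisWhitney k).Database n

/-- The restriction of `t` to the attributes of `S_j`. -/
def res (j : Fin k) (t : Fin k → Fin n) : Tup k n j := fun i => t i.1

/-- The extension of a tuple of `S_j` by a value for the missing variable. -/
def extend (j : Fin k) (u : Tup k n j) (b : Fin n) : Fin k → Fin n := fun i =>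
  if h : i ≠ j then u ⟨i, mem_vars.2 h⟩ else b

theorem res_extend (j : Fin k) (u : Tup k n j) (b : Fin n) : res j (extend j u b) = u := by
  funext i
  simp [res, extend, mem_vars.1 i.2]

theorem res_eq_iff {j : Fin k} {t t' : Fin k → Fin n} :
    res j t = res j t' ↔ ∀ i, i ≠ j → t i = t' i :=
  ⟨fun h i hi => congrFun h ⟨i, mem_vars.2 hi⟩, fun h => funext fun i => h i.1 (mem_vars.1 i.2)⟩

theorem eq_of_res_eq {j : Fin k} {t t' : Fin k → Fin n} (h : res j t = res j t') (hj : t j = t' j) :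
    t = t' := by
  funext i
  by_cases hi : i = j
  · rw [hi, hj]
  · exact res_eq_iff.1 h i hi

/-- The tuple `u` of `S_j` agrees with `t` on `U`. -/
def Agree (j : Fin k) (U : Finset (Fin k)) (t : Fin k → Fin n) (u : Tup k n j) : Prop :=
  ∀ i : (ConjunctiveQuery.loomisWhitney k).Attr j, i.1 ∈ U → u i = t i.1

theorem agree_res {j : Fin k} {U : Finset (Fin k)} {t t' : Fin k → Fin n} (hj : j ∉ U) :
    Agree j U t (res j t') ↔ ∀ i ∈ U, t' i = t i :=
  ⟨fun h i hi => h ⟨i, mem_vars.2 fun e => hj (e ▸ hi)⟩ hi, fun h i hi => h i.1 hi⟩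

/-- The number of tuples of `S_j` that agree with `t` on `U`. -/
noncomputable def deg (D : DB k n) (j : Fin k) (U : Finset (Fin k)) (t : Fin k → Fin n) : ℕ :=
  #{u ∈ D j | Agree j U t u}

theorem deg_le_card (D : DB k n) (j : Fin k) (U : Finset (Fin k)) (t : Fin k → Fin n) :
    deg D j U t ≤ #(D j) := Finset.card_filter_le _ _

theorem deg_congr (D : DB k n) (j : Fin k) {U : Finset (Fin k)} {t t' : Fin k → Fin n}
    (h : ∀ i ∈ U, t i = t' i) : deg D j U t = deg D j U t' := by
  unfold deg Agree
  congr 1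
  ext u
  simp only [mem_filter, and_congr_right_iff]
  exact fun _ => forall_congr' fun i => forall_congr' fun hi => by rw [h _ hi]

theorem deg_empty (D : DB k n) (j : Fin k) (t : Fin k → Fin n) : deg D j ∅ t = #(D j) := by
  simp [deg, Agree]

/-- The degree that the statistics `st` record: it is `0` for light patterns. -/
noncomputable def knownDeg (st : (ConjunctiveQuery.loomisWhitney k).Statistics n) (j : Fin k)
    (U : Finset (Fin k)) (t : Fin k → Fin n) : ℕ :=
  st j (univ.filter fun i => i.1 ∈ U) (res j t)

theorem frequency_eq_deg (D : DB k n) (j : Fin k) (U : Finset (Fin k)) (t : Fin k → Fin n) :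
    (ConjunctiveQuery.loomisWhitney k).frequency D j (univ.filter fun i => i.1 ∈ U) (res j t) =
      deg D j U t := by
  unfold ConjunctiveQuery.frequency deg Agree
  congr 1
  ext u
  simp [res]

theorem knownDeg_eq {D : DB k n} {m : ℕ} (hD : ∀ j, #(D j) = m) (p : ℕ) (j : Fin k)
    (U : Finset (Fin k)) (t : Fin k → Fin n) :
    knownDeg ((ConjunctiveQuery.loomisWhitney k).heavyHitters p D) j U t =
      if m < p * deg D j U t then deg D j U t else 0 := by
  unfold knownDeg ConjunctiveQuery.heavyHitters
  rw [frequency_eq_deg, hD]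

/-- `t` restricted to `U` is heavy in a relation that has all the variables in `U`. -/
def Heavy (d : Fin k → Finset (Fin k) → (Fin k → Fin n) → ℕ) (m g : ℕ) (U : Finset (Fin k))
    (t : Fin k → Fin n) : Prop :=
  ∃ l, l ∉ U ∧ m < d l U t * g ^ #U

def MinHeavy (d : Fin k → Finset (Fin k) → (Fin k → Fin n) → ℕ) (m g : ℕ) (U : Finset (Fin k))
    (t : Fin k → Fin n) : Prop :=
  Heavy d m g U t ∧ ∀ i ∈ U, ¬ Heavy d m g (U.erase i) t

/-- Since `g^#U ≤ p`, the heaviness threshold `m / g^#U` is at least `m / p`, and all frequencies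
above `m / p` are recorded. The servers can therefore decide heaviness without communication. -/
theorem heavy_knownDeg {D : DB k n} {m p g : ℕ} (hD : ∀ j, #(D j) = m) (hg : 1 ≤ g)
    (hgp : g ^ k ≤ p) :
    Heavy (knownDeg ((ConjunctiveQuery.loomisWhitney k).heavyHitters p D)) m g =
      Heavy (deg D) m g := by
  funext U t
  unfold Heavy
  simp only [knownDeg_eq hD, eq_iff_iff]
  refine exists_congr fun l => and_congr_right fun _ => ?_
  split_ifs with h
  · rfl
  · simp only [zero_mul, not_lt_zero, false_iff, not_lt]
    have : g ^ #U ≤ p := (Nat.pow_le_pow_right hg (by simpa using card_le_univ U)).trans hgp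
    calc deg D l U t * g ^ #U ≤ deg D l U t * p := by gcongr
      _ ≤ m := by rw [mul_comm]; omega

theorem heavy_congr (D : DB k n) (m g : ℕ) {U : Finset (Fin k)} {t t' : Fin k → Fin n}
    (h : ∀ i ∈ U, t i = t' i) : Heavy (deg D) m g U t ↔ Heavy (deg D) m g U t' := by
  unfold Heavy
  simp only [deg_congr D _ h]

theorem minHeavy_congr (D : DB k n) (m g : ℕ) {U : Finset (Fin k)} {t t' : Fin k → Fin n}
    (h : ∀ i ∈ U, t i = t' i) : MinHeavy (deg D) m g U t ↔ MinHeavy (deg D) m g U t' := by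
  unfold MinHeavy
  rw [heavy_congr D m g h]
  refine and_congr_right fun _ => forall_congr' fun i => forall_congr' fun hi => not_congr ?_
  exact heavy_congr D m g fun a ha => h a (mem_of_mem_erase ha)

theorem exists_minHeavy (d : Fin k → Finset (Fin k) → (Fin k → Fin n) → ℕ) (m g : ℕ)
    {t : Fin k → Fin n} {U : Finset (Fin k)} (h : Heavy d m g U t) :
    ∃ V, MinHeavy d m g V t := by
  induction U using Finset.strongInduction with
  | H U ih =>
    by_cases hU : ∃ i ∈ U, Heavy d m g (U.erase i) t
    · obtain ⟨i, hi, hh⟩ := hU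
      exact ih _ (erase_ssubset hi) hh
    · push Not at hU
      exact ⟨U, h, hU⟩

theorem not_heavy_empty {D : DB k n} {m : ℕ} (hD : ∀ j, #(D j) = m) (g : ℕ) (t : Fin k → Fin n) :
    ¬ Heavy (deg D) m g ∅ t := by
  simp [Heavy, deg_empty, hD]

/-- This is how minimality is exploited: after dropping `i` the pattern is light, hence has
frequency at most `g * (m / g^#U)` also in `S_i`, to which heaviness of `U` itself does not refer.
-/
theorem deg_erase_le_of_minHeavy {D : DB k n} {m g : ℕ} {U : Finset (Fin k)} {t : Fin k → Fin n}
    (h : MinHeavy (deg D) m g U t) {i l : Fin k} (hi : i ∈ U) (hl : l ∉ U.erase i) :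
    deg D l (U.erase i) t * g ^ #U ≤ g * m := by
  have h1 := h.2 i hi
  unfold Heavy at h1
  push Not at h1
  have h2 := h1 l hl
  rw [card_erase_of_mem hi] at h2
  have h3 : g ^ #U = g * g ^ (#U - 1) := by
    rw [← pow_succ', Nat.sub_add_cancel (card_pos.2 ⟨i, hi⟩)]
  rw [h3, mul_left_comm]
  gcongr

/-! ### Counting candidates with minimal heavy patterns. -/

/-- The tuples that agree with `S_i` and have a minimal heavy pattern on `U`. -/
noncomputable def cand (D : DB k n) (m g : ℕ) (i : Fin k) (U : Finset (Fin k)) :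
    Finset (Fin k → Fin n) :=
  {t | MinHeavy (deg D) m g U t ∧ res i t ∈ D i}

/-- Sorts the tuples by a relation that witnesses heaviness; this costs the factor `k` in the counts
below. -/
theorem card_le_of_heavy_cover {τ : Type*} {D : DB k n} {m g : ℕ} (U : Finset (Fin k))
    (T : Finset τ) (f : τ → Fin k → Fin n) (hT : ∀ t ∈ T, Heavy (deg D) m g U (f t)) {N : ℕ}
    (h : ∀ l, l ∉ U → #{t ∈ T | m < deg D l U (f t) * g ^ #U} ≤ N) : #T ≤ k * N := by
  have h1 : T ⊆ (univ.filter fun l => l ∉ U).biUnion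
      fun l => {t ∈ T | m < deg D l U (f t) * g ^ #U} := by
    intro t ht
    obtain ⟨l, hl, hm⟩ := hT t ht
    simp only [mem_biUnion, mem_filter, mem_univ, true_and]
    exact ⟨l, hl, ht, hm⟩
  refine (card_le_card h1).trans ((card_biUnion_le_card_mul _ _ N fun l hl =>
    h l (mem_filter.1 hl).2).trans ?_)
  gcongr
  simpa using card_le_univ (univ.filter fun l : Fin k => l ∉ U)

theorem sum_deg_eq {τ : Type*} (D : DB k n) (l : Fin k) (U : Finset (Fin k)) (T : Finset τ)
    (f : τ → Fin k → Fin n) :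
    ∑ t ∈ T, deg D l U (f t) = ∑ u ∈ D l, #{t ∈ T | Agree l U (f t) u} := by
  have := sum_card_bipartiteAbove_eq_sum_card_bipartiteBelow (s := T) (t := D l)
    (fun t u => Agree l U (f t) u)
  simpa [bipartiteAbove, bipartiteBelow, deg] using this

theorem card_mul_le_sum_deg {τ : Type*} (D : DB k n) (l : Fin k) {m G : ℕ} (U : Finset (Fin k))
    (T : Finset τ) (f : τ → Fin k → Fin n) (hT : ∀ t ∈ T, m ≤ deg D l U (f t) * G) :
    #T * m ≤ (∑ t ∈ T, deg D l U (f t)) * G := by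
  rw [sum_mul, ← smul_eq_mul]
  exact card_nsmul_le_sum _ _ _ hT

/-- Double counting of pairs of a candidate and a tuple of the witnessing `S_l` that agree on `U`.
Each candidate lies in more than `m / g^#U` pairs, while each of the `m` tuples of `S_l` lies in at
most `g * m / g^#U`. -/
theorem card_cand_le {D : DB k n} {m g : ℕ} (hm : 0 < m) (hD : ∀ j, #(D j) = m) {i : Fin k}
    {U : Finset (Fin k)} (hi : i ∈ U) : #(cand D m g i U) ≤ k * (g * m) := by
  have hmem : ∀ t ∈ cand D m g i U, MinHeavy (deg D) m g U t ∧ res i t ∈ D i := fun t ht =>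
    (mem_filter.1 ht).2
  refine card_le_of_heavy_cover U _ id (fun t ht => (hmem t ht).1.1) fun l hl => ?_
  set T := (cand D m g i U).filter fun t => m < deg D l U (id t) * g ^ #U with hT
  have h1 := card_mul_le_sum_deg D l U T id (m := m) (G := g ^ #U)
    fun t ht => (mem_filter.1 ht).2.le
  rw [sum_deg_eq, sum_mul] at h1
  -- The tuple `u` fixes the candidate on `U`, including at `i`, so the candidate is determined by
  -- its restriction in `S_i`, which carries a prescribed light pattern on `U.erase i`.
  have h2 : ∀ u ∈ D l, #{t ∈ T | Agree l U (id t) u} * g ^ #U ≤ g * m := by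
    intro u _
    rcases ({t ∈ T | Agree l U (id t) u} : Finset (Fin k → Fin n)).eq_empty_or_nonempty with h | ⟨t₀, ht₀⟩
    · rw [h]; simp
    · have hag : ∀ t ∈ ({t ∈ T | Agree l U (id t) u} : Finset (Fin k → Fin n)),
          t ∈ cand D m g i U ∧ ∀ a ∈ U, t a = t₀ a := by
        intro t ht
        refine ⟨(mem_filter.1 (mem_filter.1 ht).1).1, fun a ha => ?_⟩
        have hal : a ∈ (ConjunctiveQuery.loomisWhitney k).vars l :=
          mem_vars.2 fun e => hl (e ▸ ha)
        exact ((mem_filter.1 ht).2 ⟨a, hal⟩ ha).symm.trans ((mem_filter.1 ht₀).2 ⟨a, hal⟩ ha)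
      refine le_trans ?_ (deg_erase_le_of_minHeavy (hmem _ (hag _ ht₀).1).1 hi (notMem_erase i U))
      gcongr
      refine card_le_card_of_injOn (res i) (fun t ht => ?_) fun t ht t' ht' e => ?_
      · have := hag t ht
        simp only [coe_filter, Set.mem_ofPred_eq]
        exact ⟨(hmem t this.1).2, (agree_res (notMem_erase i U)).2
          fun a ha => this.2 a (mem_of_mem_erase ha)⟩
      · exact eq_of_res_eq e (((hag t ht).2 i hi).trans ((hag t' ht').2 i hi).symm)
  have h3 := h1.trans (sum_le_card_nsmul _ _ _ h2)
  rw [hD, smul_eq_mul, mul_comm m] at h3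
  exact Nat.le_of_mul_le_mul_right h3 hm

/-- The tuples differ only at `j ∈ U`, so their sets of matching tuples in a witnessing `S_l` are
disjoint. Each set has more than `m / g^#U` elements, and all of them share one light pattern on
`U.erase j`, which leaves room for at most `g`. -/
theorem card_minHeavy_fiber_le {D : DB k n} {m g : ℕ} (hm : 0 < m) {j : Fin k}
    {U : Finset (Fin k)} (hj : j ∈ U) (v : Tup k n j) :
    #{t | MinHeavy (deg D) m g U t ∧ res j t = v} ≤ k * g := by
  refine card_le_of_heavy_cover U _ id (fun t ht => (mem_filter.1 ht).2.1.1) fun l hl => ?_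
  set T := (univ.filter fun t => MinHeavy (deg D) m g U t ∧ res j t = v).filter
    fun t => m < deg D l U (id t) * g ^ #U with hT
  rcases T.eq_empty_or_nonempty with h | ⟨t₀, ht₀⟩
  · simp [h]
  have hmem : ∀ t ∈ T, MinHeavy (deg D) m g U t ∧ res j t = v := fun t ht =>
    (mem_filter.1 (mem_filter.1 ht).1).2
  have h1 := card_mul_le_sum_deg D l U T id (m := m) (G := g ^ #U)
    fun t ht => (mem_filter.1 ht).2.le
  have h2 : ∑ t ∈ T, deg D l U (id t) ≤ deg D l (U.erase j) t₀ := by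
    unfold deg
    rw [← card_biUnion]
    · refine card_le_card fun u hu => ?_
      simp only [mem_biUnion, mem_filter] at hu ⊢
      obtain ⟨t, ht, hu, hag⟩ := hu
      refine ⟨hu, fun a ha => (hag a (mem_of_mem_erase ha)).trans ?_⟩
      exact res_eq_iff.1 ((hmem t ht).2.trans (hmem t₀ ht₀).2.symm) _ (ne_of_mem_erase ha)
    · intro t ht t' ht' hne
      rw [Function.onFun, disjoint_left]
      intro u hu hu'
      simp only [mem_filter] at hu hu'
      have hjl : j ∈ (ConjunctiveQuery.loomisWhitney k).vars l := mem_vars.2 fun e => hl (e ▸ hj)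
      exact hne (eq_of_res_eq ((hmem t ht).2.trans (hmem t' ht').2.symm)
        ((hu.2 ⟨j, hjl⟩ hj).symm.trans (hu'.2 ⟨j, hjl⟩ hj)))
  have h3 := deg_erase_le_of_minHeavy (hmem t₀ ht₀).1 hj (fun h => hl (mem_of_mem_erase h))
  exact Nat.le_of_mul_le_mul_right (h1.trans ((Nat.mul_le_mul_right _ h2).trans h3)) hm

/-! ### Frequent patterns and the cost of replication. -/

/-- The patterns on `U` of frequency more than `m / p` in `S_i`, filled up with the values of
`w₀` outside of `U`. -/
noncomputable def frequentPatterns (D : DB k n) (m p : ℕ) (w₀ : Fin k → Fin n) (i : Fin k)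
    (U : Finset (Fin k)) : Finset (Fin k → Fin n) :=
  {w | (∀ a, a ∉ U → w a = w₀ a) ∧ m < p * deg D i U w}

theorem card_frequentPatterns_le {D : DB k n} {m : ℕ} (hm : 0 < m) (hD : ∀ j, #(D j) = m) (p : ℕ)
    (w₀ : Fin k → Fin n) {i : Fin k} {U : Finset (Fin k)} (hi : i ∉ U) :
    #(frequentPatterns D m p w₀ i U) ≤ p := by
  set T := frequentPatterns D m p w₀ i U with hT
  have h1 := card_mul_le_sum_deg D i U T id (m := m) (G := p) fun t ht => by
    rw [mul_comm]; exact (mem_filter.1 ht).2.2.le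
  -- A tuple of `S_i` supports only one pattern on `U`; the filling by `w₀` makes this pattern a
  -- single function.
  have h2 : ∑ t ∈ T, deg D i U (id t) ≤ m := by
    rw [sum_deg_eq, ← hD i, card_eq_sum_ones]
    refine sum_le_sum fun u _ => card_le_one.2 fun t ht t' ht' => ?_
    simp only [mem_filter] at ht ht'
    funext a
    by_cases ha : a ∈ U
    · have hai : a ∈ (ConjunctiveQuery.loomisWhitney k).vars i := mem_vars.2 fun e => hi (e ▸ ha)
      exact (ht.2 ⟨a, hai⟩ ha).symm.trans (ht'.2 ⟨a, hai⟩ ha)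
    · rw [(mem_filter.1 ht.1).2.1 a ha, (mem_filter.1 ht'.1).2.1 a ha]
  refine Nat.le_of_mul_le_mul_right (c := m) ?_ hm
  calc _ ≤ _ := h1
    _ ≤ m * p := Nat.mul_le_mul_right _ h2
    _ = _ := mul_comm _ _

theorem exists_frequentPattern {D : DB k n} {m p : ℕ} (w₀ : Fin k → Fin n) {i : Fin k}
    {U : Finset (Fin k)} {t : Fin k → Fin n} (h : m < p * deg D i U t) :
    ∃ w ∈ frequentPatterns D m p w₀ i U, ∀ a ∈ U, t a = w a := by
  have hag : ∀ a ∈ U, t a = (fun a => if a ∈ U then t a else w₀ a) a := fun a ha => by simp [ha]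
  refine ⟨fun a => if a ∈ U then t a else w₀ a, mem_filter.2 ⟨mem_univ _, ?_, ?_⟩, hag⟩
  · intro a ha; simp [ha]
  · rwa [← deg_congr D i hag]

/-- The number of servers over which the candidates with the same restriction to the attributes of
`S_j` are spread. -/
noncomputable def copies (d : Fin k → Finset (Fin k) → (Fin k → Fin n) → ℕ) (m g : ℕ) (i j : Fin k)
    (U : Finset (Fin k)) (t : Fin k → Fin n) : ℕ :=
  if j ∈ U then 1 else 1 + d i ((univ.erase i).erase j) t * g ^ (k - 1) / m

theorem copies_pos (d : Fin k → Finset (Fin k) → (Fin k → Fin n) → ℕ) (m g : ℕ) (i j : Fin k)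
    (U : Finset (Fin k)) (t : Fin k → Fin n) : 0 < copies d m g i j U t := by
  unfold copies
  split_ifs
  · exact one_pos
  · exact Nat.lt_of_lt_of_le one_pos (Nat.le_add_right _ _)

/-- One copy per tuple costs `m`. The additional copies number at most `g^(k-1) / m` times the
number of candidates, hence at most `k * g^k ≤ k * m`. -/
theorem card_copies_le {D : DB k n} {m g p : ℕ} (hm : 0 < m) (hD : ∀ j, #(D j) = m)
    (hk : 1 ≤ k) (hgm : g ^ k ≤ m) {i j : Fin k}
    (hij : j ≠ i) {U : Finset (Fin k)} (hi : i ∈ U)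
    {d : Fin k → Finset (Fin k) → (Fin k → Fin n) → ℕ} (hd : ∀ l V t, d l V t ≤ deg D l V t) :
    #{x ∈ D j ×ˢ (univ : Finset (Fin (p + 1))) | ∃ t, MinHeavy (deg D) m g U t ∧ res j t = x.1 ∧
      x.2.1 < copies d m g i j U t} ≤ (k + 1) * m := by
  by_cases hj : j ∈ U
  · refine (card_le_card_of_injOn (t := D j) Prod.fst (fun x hx => ?_) fun x hx y hy e => ?_).trans ?_
    · exact (mem_product.1 (mem_filter.1 hx).1).1
    · obtain ⟨t, -, -, h1⟩ := (mem_filter.1 hx).2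
      obtain ⟨t', -, -, h2⟩ := (mem_filter.1 hy).2
      simp only [copies, if_pos hj, Nat.lt_one_iff] at h1 h2
      exact Prod.ext e (Fin.ext (h1.trans h2.symm))
    · rw [hD]; exact Nat.le_mul_of_pos_left _ (by omega)
  set W : Finset (Fin k) := (univ.erase i).erase j with hW
  rcases isEmpty_or_nonempty (Fin n) with hn | ⟨⟨b⟩⟩
  · have : D j = ∅ := by
      refine eq_empty_of_forall_notMem fun u _ => ?_
      exact hn.elim (u ⟨i, mem_vars.2 hij.symm⟩)
    simp [this]
  -- The filler `b` at `j` is immaterial, because neither `U` nor `W` contains `j`.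
  set V : Finset (Tup k n j) := {v ∈ D j | MinHeavy (deg D) m g U (extend j v b)} with hV
  set N : Tup k n j → ℕ := fun v => deg D i W (extend j v b) with hN
  have hsub : #{x ∈ D j ×ˢ (univ : Finset (Fin (p + 1))) | ∃ t, MinHeavy (deg D) m g U t ∧
      res j t = x.1 ∧ x.2.1 < copies d m g i j U t} ≤
      #(V.sigma fun v => range (1 + N v * g ^ (k - 1) / m)) := by
    refine card_le_card_of_injOn (fun x => ⟨x.1, x.2.1⟩) (fun x hx => ?_) fun x _ y _ e => ?_
    · obtain ⟨hx1, t, ht, hr, hlt⟩ := mem_filter.1 hx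
      have hag : ∀ a, a ≠ j → t a = extend j x.1 b a :=
        res_eq_iff.1 (hr.trans (res_extend j x.1 b).symm)
      simp only [coe_sigma, Set.mem_sigma_iff, mem_coe, mem_range, hV, mem_filter]
      refine ⟨⟨(mem_product.1 hx1).1, ?_⟩, hlt.trans_le ?_⟩
      · exact (minHeavy_congr D m g fun a ha => hag a fun e => hj (e ▸ ha)).1 ht
      · simp only [copies, if_neg hj, hN]
        rw [← deg_congr D i (fun a ha => hag a (ne_of_mem_erase ha))]
        gcongr
        exact hd _ _ _
    · simp only [Sigma.mk.injEq, heq_eq_eq] at e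
      exact Prod.ext e.1 (Fin.ext e.2)
  refine hsub.trans ?_
  rw [card_sigma]
  simp only [card_range, sum_add_distrib, sum_const, smul_eq_mul, mul_one]
  have hVm : #V ≤ m := (card_filter_le _ _).trans (hD j).le
  -- A tuple `v` of `S_j` and a tuple `u` of `S_i` that agree on `W` glue to one full tuple, which
  -- is a candidate and determines both.
  have hsum : ∑ v ∈ V, N v ≤ #(cand D m g i U) := by
    have : ∑ v ∈ V, N v = #(V.sigma fun v => {u ∈ D i | Agree i W (extend j v b) u}) := by
      rw [card_sigma]; rfl
    rw [this]
    have hji : j ∈ (ConjunctiveQuery.loomisWhitney k).vars i := mem_vars.2 hij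
    have hr : ∀ x ∈ V.sigma fun v => {u ∈ D i | Agree i W (extend j v b) u},
        res i (extend j x.1 (x.2 ⟨j, hji⟩)) = x.2 := by
      intro x hx
      obtain ⟨-, hx2⟩ := mem_sigma.1 hx
      have hag := (mem_filter.1 hx2).2
      funext a
      have hai := mem_vars.1 a.2
      by_cases haj : a.1 = j
      · have : a = ⟨j, hji⟩ := Subtype.ext haj
        rw [this]
        simp [res, extend]
      · rw [hag a (by simp [hW, haj, hai])]
        simp [res, extend, haj]
    refine card_le_card_of_injOn (fun x => extend j x.1 (x.2 ⟨j, hji⟩)) (fun x hx => ?_)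
      fun x hx y hy e => ?_
    · have hx' := hr x hx
      obtain ⟨hx1, hx2⟩ := mem_sigma.1 hx
      simp only [cand, coe_filter, mem_univ, true_and, Set.mem_ofPred_eq]
      rw [hx']
      refine ⟨(minHeavy_congr D m g fun a ha => ?_).1 (mem_filter.1 hx1).2, (mem_filter.1 hx2).1⟩
      have haj : a ≠ j := fun e => hj (e ▸ ha)
      simp [extend, haj]
    · have e1 : x.1 = y.1 := by
        have := congrArg (res j) e
        simpa only [res_extend] using this
      have e2 : x.2 = y.2 := by
        rw [← hr x hx, ← hr y hy]
        exact congrArg (res i) e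
      exact Sigma.ext e1 (heq_of_eq e2)
  have hdiv : ∑ v ∈ V, N v * g ^ (k - 1) / m ≤ k * m := by
    refine Nat.le_of_mul_le_mul_right (c := m) ?_ hm
    calc (∑ v ∈ V, N v * g ^ (k - 1) / m) * m = ∑ v ∈ V, N v * g ^ (k - 1) / m * m := sum_mul _ _ _
      _ ≤ ∑ v ∈ V, N v * g ^ (k - 1) := sum_le_sum fun v _ => Nat.div_mul_le_self _ _
      _ = (∑ v ∈ V, N v) * g ^ (k - 1) := (sum_mul _ _ _).symm
      _ ≤ k * (g * m) * g ^ (k - 1) := by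
        gcongr
        exact hsum.trans (card_cand_le hm hD hi)
      _ = k * g ^ k * m := by
        rw [show g ^ k = g * g ^ (k - 1) by rw [← pow_succ', Nat.sub_add_cancel hk]]; ring
      _ ≤ k * m * m := by gcongr
  linarith

/-! ### Hypercube hashing of the light tuples. -/

theorem pow_card_le {g p : ℕ} (hg : 1 ≤ g) (hgp : g ^ k ≤ p) {N : ℕ} (hN : N ≤ k) : g ^ N ≤ p :=
  (Nat.pow_le_pow_right hg hN).trans hgp

/-- The tuples of `S_l` that extend to a tuple without heavy patterns. -/
noncomputable def lightPart (D : DB k n) (m g : ℕ) (l : Fin k) : Finset (Tup k n l) :=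
  {u ∈ D l | ∃ t, res l t = u ∧ ∀ U, ¬ Heavy (deg D) m g U t}

/-- The light tuples of `S_l` that agree with `w` on `U` and are hashed to the cell `c` in the
coordinates in `R`. -/
noncomputable def cell (D : DB k n) (m g : ℕ) (l : Fin k) (h : Fin k → Fin n → Fin g)
    (R U : Finset (Fin k)) (w : Fin k → Fin n) (c : Fin k → Fin g) : Finset (Tup k n l) :=
  {u ∈ lightPart D m g l | Agree l U w u ∧
    ∀ i : (ConjunctiveQuery.loomisWhitney k).Attr l, i.1 ∈ R → h i.1 (u i) = c i.1}

theorem card_cell_le_deg (D : DB k n) (m g : ℕ) (l : Fin k) (h : Fin k → Fin n → Fin g)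
    (R U : Finset (Fin k)) (w : Fin k → Fin n) (c : Fin k → Fin g) :
    #(cell D m g l h R U w c) ≤ deg D l U w := by
  refine card_le_card fun u hu => ?_
  have := mem_filter.1 hu
  exact mem_filter.2 ⟨(mem_filter.1 this.1).1, this.2.1⟩

theorem cell_congr (D : DB k n) (m g : ℕ) (l : Fin k) (h : Fin k → Fin n → Fin g)
    (R : Finset (Fin k)) {U : Finset (Fin k)} {w w' : Fin k → Fin n} (c : Fin k → Fin g)
    (hw : ∀ a ∈ U, w a = w' a) : cell D m g l h R U w c = cell D m g l h R U w' c := by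
  unfold cell Agree
  ext u
  simp only [mem_filter, and_congr_right_iff, and_congr_left_iff]
  exact fun _ _ => forall_congr' fun i => forall_congr' fun hi => by rw [hw _ hi]

theorem cell_update (D : DB k n) (m g : ℕ) (l : Fin k) (h : Fin k → Fin n → Fin g) {i : Fin k}
    (x : Fin n → Fin g) {R : Finset (Fin k)} (U : Finset (Fin k)) (w : Fin k → Fin n)
    (c : Fin k → Fin g) (hi : i ∉ R) :
    cell D m g l (Function.update h i x) R U w c = cell D m g l h R U w c := by
  unfold cell
  ext u
  simp only [mem_filter, and_congr_right_iff]
  refine fun _ _ => forall_congr' fun a => forall_congr' fun ha => ?_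
  have hne : a.1 ≠ i := fun e => hi (e ▸ ha)
  rw [Function.update_of_ne hne]

theorem card_cell_empty_le (D : DB k n) (m g : ℕ) {l : Fin k} (h : Fin k → Fin n → Fin g)
    {U : Finset (Fin k)} (hl : l ∉ U) (w : Fin k → Fin n) (c : Fin k → Fin g) :
    #(cell D m g l h ∅ U w c) * g ^ #U ≤ m := by
  rcases (cell D m g l h ∅ U w c).eq_empty_or_nonempty with h0 | ⟨u, hu⟩
  · rw [h0]; simp
  · have hu' := mem_filter.1 hu
    obtain ⟨t, rfl, ht⟩ := (mem_filter.1 hu'.1).2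
    have h1 := ht U
    unfold Heavy at h1
    push Not at h1
    refine le_trans ?_ (h1 l hl)
    gcongr
    rw [deg_congr D l ((agree_res hl).1 hu'.2.1)]
    exact card_cell_le_deg D m g l h ∅ U w c

/-- The expected size of a cell when one more coordinate is hashed, up to the factor that has been
lost for the coordinates in `R`. -/
noncomputable def cellBound (m g : ℕ) (K : ℝ) (R U : Finset (Fin k)) : ℝ :=
  K ^ #R * m / (g : ℝ) ^ (#U + #R + 1)

/-- Hashing the coordinate `i` overloads a cell, although the coordinates in `R` behave well. -/
def Overload (D : DB k n) (m g : ℕ) (σ : ℝ) (l : Fin k) (R : Finset (Fin k)) (i : Fin k)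
    (U : Finset (Fin k)) (w : Fin k → Fin n) (c : Fin k → Fin g) (h : Fin k → Fin n → Fin g) :
    Prop :=
  (i ∉ R ∧ i ∉ U ∧ i ≠ l) ∧
    (∀ b, (#(cell D m g l h R (insert i U) (Function.update w i b) c) : ℝ) ≤
      cellBound m g (2 + σ) R U) ∧
    (#(cell D m g l h R U w c) : ℝ) ≤ g * cellBound m g (2 + σ) R U ∧
    (2 + σ) * cellBound m g (2 + σ) R U < #(cell D m g l h (insert i R) U w c)

/-- Only the hash function of `i` is resampled. The size conditions inside `Overload` concern
coordinates in `R`, to which `i` does not belong, so they are unaffected and serve as hypotheses of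
the Chernoff bound, with key weight `B`, total `g * B` and hitting probability `1 / g`. -/
theorem unifProb_overload_le {D : DB k n} {m g : ℕ} (hm : 0 < m) (hg : 1 ≤ g) {σ : ℝ} (hσ : 0 ≤ σ)
    (l : Fin k) (R : Finset (Fin k)) (i : Fin k) (U : Finset (Fin k)) (w : Fin k → Fin n)
    (c : Fin k → Fin g) : unifProb (Overload D m g σ l R i U w c) ≤ Real.exp (-σ) := by
  have hg0 : (0 : ℝ) < g := by exact_mod_cast hg
  have hm0 : (0 : ℝ) < m := by exact_mod_cast hm
  have : Nonempty (Fin g) := ⟨⟨0, hg⟩⟩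
  set B := cellBound m g (2 + σ) R U with hB
  have hB0 : 0 < B := by rw [hB]; unfold cellBound; positivity
  refine unifProb_pi_update i (Real.exp_pos _).le fun f => ?_
  by_cases hc : (i ∉ R ∧ i ∉ U ∧ i ≠ l) ∧
    (∀ b, (#(cell D m g l f R (insert i U) (Function.update w i b) c) : ℝ) ≤ B) ∧
    (#(cell D m g l f R U w c) : ℝ) ≤ g * B
  · obtain ⟨⟨hiR, hiU, hil⟩, hb, ht⟩ := hc
    have hiv : i ∈ (ConjunctiveQuery.loomisWhitney k).vars l := mem_vars.2 hil
    have hkey : ∀ b, ∀ A' ⊆ cell D m g l f R U w c, (∀ u ∈ A', u ⟨i, hiv⟩ = b) →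
        (#A' : ℝ) ≤ B := by
      intro b A' hA' hA
      refine le_trans ?_ (hb b)
      norm_cast
      refine card_le_card fun u hu => ?_
      have hu' := mem_filter.1 (hA' hu)
      refine mem_filter.2 ⟨hu'.1, fun a ha => ?_, hu'.2.2⟩
      by_cases hai : a.1 = i
      · have : a = ⟨i, hiv⟩ := Subtype.ext hai
        rw [this]
        simpa using hA u hu
      · rw [Function.update_of_ne hai]
        exact hu'.2.1 a ((mem_insert.1 ha).resolve_left hai)
    have hS : (#{c i} : ℝ) ≤ 1 / (g : ℝ) * Fintype.card (Fin g) := by simp [hg0.ne']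
    have hash := unifProb_hash (cell D m g l f R U w c) (fun u => u ⟨i, hiv⟩) {c i} hS (B := B) hB0
      hkey (T := g * B) ht σ
    refine le_trans (unifProb_mono fun x hx => ?_) hash
    have h1 := hx.2.2.2
    have e1 : 2 * (1 / (g : ℝ)) * (g * B) + σ * B = (2 + σ) * B := by field_simp
    rw [e1]
    refine ⟨_, fun u hu => ?_, fun u hu => ?_, h1⟩
    · have hu' := mem_filter.1 hu
      refine mem_filter.2 ⟨hu'.1, hu'.2.1, fun a ha => ?_⟩
      have := hu'.2.2 a (mem_insert_of_mem ha)
      have hne : a.1 ≠ i := fun e => hiR (e ▸ ha)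
      rwa [Function.update_of_ne hne] at this
    · have := (mem_filter.1 hu).2.2 ⟨i, hiv⟩ (mem_insert_self _ _)
      simpa using this
  · refine (unifProb_mono (F := fun _ => False) fun x hx => hc ?_).trans ?_
    · have hx' := hx
      obtain ⟨h1, h2, h3, -⟩ := hx'
      simp only [cell_update D m g l f x _ _ c h1.1] at h2 h3
      exact ⟨h1, h2, h3⟩
    · simpa [unifProb] using (Real.exp_pos _).le

/-- The hash functions of the variables overload no cell. -/
def CellsGood (D : DB k n) (m p g : ℕ) (σ : ℝ) (w₀ : Fin k → Fin n)
    (h : Fin k → Fin n → Fin g) : Prop :=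
  ∀ l R i U, l ∉ U → ∀ w ∈ frequentPatterns D m p w₀ l U, ∀ c, ¬ Overload D m g σ l R i U w c h

/-- There are `k^2 * 4^k` choices of `(l, R, i, U)`, at most `p` frequent patterns and `g^k ≤ p`
cells. -/
theorem unifProb_not_cellsGood_le {D : DB k n} {m p g : ℕ} (hm : 0 < m) (hD : ∀ j, #(D j) = m)
    (hg : 1 ≤ g) (hgp : g ^ k ≤ p) {σ : ℝ} (hσ : 0 ≤ σ) (w₀ : Fin k → Fin n) :
    unifProb (fun h => ¬ CellsGood D m p g σ w₀ h) ≤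
      (k : ℝ) ^ 2 * 4 ^ k * p ^ 2 * Real.exp (-σ) := by
  have h1 : ∀ x : Fin k × Finset (Fin k) × Fin k × Finset (Fin k),
      unifProb (fun h : Fin k → Fin n → Fin g => x.1 ∉ x.2.2.2 ∧
        ∃ w ∈ frequentPatterns D m p w₀ x.1 x.2.2.2, ∃ c ∈ (univ : Finset (Fin k → Fin g)),
          Overload D m g σ x.1 x.2.1 x.2.2.1 x.2.2.2 w c h) ≤ p * (p * Real.exp (-σ)) := by
    intro x
    by_cases hx : x.1 ∉ x.2.2.2
    · refine (unifProb_mono fun h hh => hh.2).trans ?_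
      refine (unifProb_exists_le _ _ fun w hw => unifProb_exists_le _ _ fun c _ =>
        unifProb_overload_le hm hg hσ _ _ _ _ _ _).trans ?_
      have hc : ((#(univ : Finset (Fin k → Fin g)) : ℕ) : ℝ) ≤ p := by
        simp only [card_univ, Fintype.card_fun, Fintype.card_fin]
        exact_mod_cast hgp
      have hw : (#(frequentPatterns D m p w₀ x.1 x.2.2.2) : ℝ) ≤ p := by
        exact_mod_cast card_frequentPatterns_le hm hD p w₀ hx
      gcongr
    · refine (unifProb_mono (F := fun _ => False) fun h hh => hx hh.1).trans ?_
      simp only [unifProb, filter_false, card_empty, Nat.cast_zero, zero_div]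
      positivity
  refine (unifProb_mono (F := fun h => ∃ x ∈ (univ : Finset (Fin k × Finset (Fin k) × Fin k ×
    Finset (Fin k))), x.1 ∉ x.2.2.2 ∧ ∃ w ∈ frequentPatterns D m p w₀ x.1 x.2.2.2,
      ∃ c ∈ (univ : Finset (Fin k → Fin g)),
        Overload D m g σ x.1 x.2.1 x.2.2.1 x.2.2.2 w c h) fun h hh => ?_).trans
    ((unifProb_exists_le _ _ fun x _ => h1 x).trans (le_of_eq ?_))
  · unfold CellsGood at hh
    push Not at hh
    obtain ⟨l, R, i, U, hl, w, hw, c, ho⟩ := hh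
    exact ⟨(l, R, i, U), mem_univ _, hl, w, hw, c, mem_univ _, ho⟩
  · simp only [card_univ, Fintype.card_prod, Fintype.card_fin, Fintype.card_finset]
    push_cast
    rw [show (4 : ℝ) = 2 * 2 by norm_num, mul_pow]
    ring

/-- Induction on the hashed coordinates, simultaneously for all fixed patterns: to hash one more
coordinate `i` one needs the bound for `U` (the total) and for `insert i U` (the weight of one value
at `i`). -/
theorem card_cell_le {D : DB k n} {m p g : ℕ} (hg : 1 ≤ g) (hgp : g ^ k ≤ p) {σ : ℝ} (hσ : 0 ≤ σ)
    {w₀ : Fin k → Fin n} {h : Fin k → Fin n → Fin g} (hh : CellsGood D m p g σ w₀ h) {l : Fin k}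
    (R : Finset (Fin k)) : ∀ (_ : l ∉ R) (U : Finset (Fin k)) (_ : l ∉ U) (_ : Disjoint R U)
      (w : Fin k → Fin n) (c : Fin k → Fin g),
      (#(cell D m g l h R U w c) : ℝ) * (g : ℝ) ^ (#U + #R) ≤ (2 + σ) ^ #R * m := by
  have hg0 : (0 : ℝ) < g := by exact_mod_cast hg
  induction R using Finset.induction_on with
  | empty =>
    intro _ U hU _ w c
    simpa using (by exact_mod_cast card_cell_empty_le D m g h hU w c :
      (#(cell D m g l h ∅ U w c) : ℝ) * (g : ℝ) ^ #U ≤ m)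
  | insert i R hi ih =>
    intro hlR U hlU hdisj w c
    rw [disjoint_insert_left] at hdisj
    have hil : i ≠ l := fun e => hlR (e ▸ mem_insert_self _ _)
    have hlR' : l ∉ R := fun h => hlR (mem_insert_of_mem h)
    rw [card_insert_of_notMem hi]
    by_cases hfr : m < p * deg D l U w
    · obtain ⟨w', hw', hag⟩ := exists_frequentPattern w₀ hfr
      rw [cell_congr D m g l h _ c hag]
      have hno := hh l R i U hlU w' hw' c
      have hB : (#(cell D m g l h (insert i R) U w' c) : ℝ) ≤
          (2 + σ) * cellBound m g (2 + σ) R U := by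
        by_contra hlt
        refine hno ⟨⟨hi, hdisj.1, hil⟩, fun b => ?_, ?_, not_le.1 hlt⟩
        · have := ih hlR' (insert i U) (by simp [hil.symm, hlU])
            (by rw [disjoint_insert_right]; exact ⟨hi, hdisj.2⟩) (Function.update w' i b) c
          rw [card_insert_of_notMem hdisj.1] at this
          unfold cellBound
          rw [le_div_iff₀ (by positivity)]
          rwa [show #U + #R + 1 = #U + 1 + #R by ring]
        · have := ih hlR' U hlU hdisj.2 w' c
          unfold cellBound
          rw [← mul_div_assoc, le_div_iff₀ (by positivity), pow_succ, ← mul_assoc, mul_comm (g : ℝ)]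
          gcongr
      unfold cellBound at hB
      rw [← mul_div_assoc, le_div_iff₀ (by positivity)] at hB
      rw [← add_assoc]
      refine hB.trans_eq ?_
      ring
    -- An infrequent pattern has at most `m / p` tuples in all, which is within the bound whatever
    -- the hashing does.
    · have h1 : #U + (#R + 1) ≤ k := by
        rw [← card_insert_of_notMem hi, ← card_union_of_disjoint (by
          rw [disjoint_insert_right]; exact ⟨hdisj.1, hdisj.2.symm⟩)]
        simpa using card_le_univ (U ∪ insert i R)
      have h2 : #(cell D m g l h (insert i R) U w c) * g ^ (#U + (#R + 1)) ≤ m := by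
        calc _ ≤ deg D l U w * p :=
              Nat.mul_le_mul (card_cell_le_deg _ _ _ _ _ _ _ _ _) (pow_card_le hg hgp h1)
          _ ≤ m := by rw [mul_comm]; omega
      have h3 : (1 : ℝ) ≤ (2 + σ) ^ (#R + 1) := one_le_pow₀ (by linarith)
      calc (_ : ℝ) ≤ m := by exact_mod_cast h2
        _ ≤ _ := le_mul_of_one_le_left (by positivity) h3

theorem card_hypercube_le {D : DB k n} {m p g : ℕ} (hg : 1 ≤ g) (hgp : g ^ k ≤ p) {σ : ℝ}
    (hσ : 0 ≤ σ) {w₀ : Fin k → Fin n} {h : Fin k → Fin n → Fin g} (hh : CellsGood D m p g σ w₀ h)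
    (l : Fin k) (c : Fin k → Fin g) :
    (#{u ∈ lightPart D m g l | ∀ i : (ConjunctiveQuery.loomisWhitney k).Attr l,
      h i.1 (u i) = c i.1} : ℝ) ≤ (2 + σ) ^ (k - 1) * (m / (g : ℝ) ^ (k - 1)) := by
  have hg0 : (0 : ℝ) < g := by exact_mod_cast hg
  have h1 := card_cell_le hg hgp hσ hh (univ.erase l) (notMem_erase l univ) ∅ (by simp) (by simp)
    w₀ c
  rw [card_erase_of_mem (mem_univ l)] at h1
  simp only [card_empty, zero_add, card_univ, Fintype.card_fin] at h1
  rw [← mul_div_assoc, le_div_iff₀ (by positivity)]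
  refine le_trans ?_ h1
  gcongr
  intro u hu
  rw [mem_filter] at hu
  exact mem_filter.2 ⟨hu.1, fun i hi => by simp at hi, fun i _ => hu.2 i⟩

/-! ### Splitting frequent patterns by residues of a random hash. -/

theorem card_mod_eq_le {P A : ℕ} (hA : 0 < A) (hAP : A ≤ P) (a : ℕ) :
    (#{y : Fin P | y.1 % A = a} : ℝ) ≤ 2 / A * Fintype.card (Fin P) := by
  have h1 : #{y : Fin P | y.1 % A = a} ≤ P / A + 1 := by
    rw [← card_range (P / A + 1)]
    refine card_le_card_of_injOn (fun y => y.1 / A) (fun y _ => ?_) fun y hy z hz e => ?_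
    · simp only [coe_range, Set.mem_Iio]
      exact Nat.lt_succ_of_le (Nat.div_le_div_right y.2.le)
    · have hy' := (mem_filter.1 hy).2
      have hz' := (mem_filter.1 hz).2
      refine Fin.ext ?_
      rw [← Nat.div_add_mod y.1 A, ← Nat.div_add_mod z.1 A, hy', hz']
      simp only at e
      rw [e]
  have hA0 : (0 : ℝ) < A := by exact_mod_cast hA
  have h2 : (1 : ℝ) ≤ P / A := by rw [le_div_iff₀ hA0]; simpa using (by exact_mod_cast hAP : (A : ℝ) ≤ P)
  have h3 : ((P / A : ℕ) : ℝ) ≤ P / A := Nat.cast_div_le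
  rw [Fintype.card_fin]
  calc (#{y : Fin P | y.1 % A = a} : ℝ) ≤ ((P / A + 1 : ℕ) : ℝ) := by exact_mod_cast h1
    _ ≤ P / A + P / A := by push_cast; linarith
    _ = _ := by ring

/-- The number of parts into which the extensions of the pattern `w` on all variables except `i` and
`j` are split. -/
noncomputable def parts (D : DB k n) (m g : ℕ) (i j : Fin k) (w : Fin k → Fin n) : ℕ :=
  1 + deg D i ((univ.erase i).erase j) w * g ^ (k - 1) / m

/-- The tuples of `S_i` in one part of the extensions of a pattern. -/
noncomputable def part (D : DB k n) (m p g : ℕ) {i j : Fin k} (hij : j ≠ i) (w : Fin k → Fin n)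
    (f : Fin n → Fin (p + 1)) (a : ℕ) : Finset (Tup k n i) :=
  {u ∈ D i | Agree i ((univ.erase i).erase j) w u ∧
    (f (u ⟨j, mem_vars.2 hij⟩)).1 % parts D m g i j w = a}

/-- With all variables except `i` and `j` fixed, a tuple of `S_i` is determined by its value at `j`,
so every key has weight one. A residue class modulo `A = parts D m g i j w` is hit with probability
at most `2 / A`, and `deg / A ≤ m / g^(k-1)`. -/
theorem unifProb_part_le {D : DB k n} {m p g : ℕ} (hm : 0 < m) (hD : ∀ j, #(D j) = m)
    (hg : 1 ≤ g) (hgp : g ^ k ≤ p) {i j : Fin k} (hij : j ≠ i) (w : Fin k → Fin n) (a : ℕ)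
    (σ : ℝ) :
    unifProb (fun f : Fin n → Fin (p + 1) =>
      4 * (m / (g : ℝ) ^ (k - 1)) + σ < #(part D m p g hij w f a)) ≤ Real.exp (-σ) := by
  have hg0 : (0 : ℝ) < g := by exact_mod_cast hg
  have hm0 : (0 : ℝ) < m := by exact_mod_cast hm
  set W := (univ.erase i).erase j with hW
  set A := parts D m g i j w with hA
  have hA0 : 0 < A := Nat.lt_of_lt_of_le one_pos (Nat.le_add_right _ _)
  have hA0' : (0 : ℝ) < A := by exact_mod_cast hA0
  -- The number of parts can be as large as `p + 1`, which is why the hash takes values in `Fin (p +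
  -- 1)`.
  have hAp : A ≤ p + 1 := by
    rw [hA, parts, add_comm]
    refine Nat.succ_le_succ (Nat.div_le_of_le_mul ?_)
    exact Nat.mul_le_mul ((deg_le_card _ _ _ _).trans (hD i).le)
      (pow_card_le hg hgp (Nat.sub_le _ _))
  have hdA : (deg D i W w : ℝ) / A ≤ m / (g : ℝ) ^ (k - 1) := by
    rw [div_le_div_iff₀ hA0' (by positivity)]
    have : deg D i W w * g ^ (k - 1) < m * A := by
      rw [hA, parts, add_comm 1]
      exact Nat.lt_mul_div_succ _ hm
    exact_mod_cast this.le
  set E : Finset (Tup k n i) := {u ∈ D i | Agree i W w u} with hE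
  have hkey : ∀ b, ∀ A' ⊆ E, (∀ u ∈ A', u ⟨j, mem_vars.2 hij⟩ = b) → (#A' : ℝ) ≤ 1 := by
    intro b A' hA' hb
    norm_cast
    refine card_le_one.2 fun u hu v hv => ?_
    have hu' := (mem_filter.1 (hA' hu)).2
    have hv' := (mem_filter.1 (hA' hv)).2
    funext c
    by_cases hcj : c.1 = j
    · have : c = ⟨j, mem_vars.2 hij⟩ := Subtype.ext hcj
      rw [this, hb u hu, hb v hv]
    · have hc : c.1 ∈ W := by simp [hW, hcj, mem_vars.1 c.2]
      rw [hu' c hc, hv' c hc]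
  have hT : (#E : ℝ) ≤ deg D i W w := by
    rw [deg]
  have hash := unifProb_hash E (fun u => u ⟨j, mem_vars.2 hij⟩) _
    (card_mod_eq_le hA0 hAp a) (B := 1) one_pos hkey (T := (deg D i W w : ℝ)) hT σ
  refine le_trans (unifProb_mono fun f hf => ?_) hash
  have e1 : 2 * (2 / (A : ℝ)) * deg D i W w + σ * 1 = 4 * (deg D i W w / A) + σ := by ring
  rw [e1]
  refine ⟨_, fun u hu => ?_, fun u hu => ?_, lt_of_le_of_lt (by linarith) hf⟩
  · have hu' := mem_filter.1 hu
    exact mem_filter.2 ⟨hu'.1, hu'.2.1⟩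
  · exact mem_filter.2 ⟨mem_univ _, (mem_filter.1 hu).2.2⟩

/-- The patterns of high frequency are split evenly. -/
def SplitGood (D : DB k n) (m p g : ℕ) (σ : ℝ) (w₀ : Fin k → Fin n) (f : Fin n → Fin (p + 1)) :
    Prop :=
  ∀ (i j : Fin k) (hij : j ≠ i), ∀ w ∈ frequentPatterns D m p w₀ i ((univ.erase i).erase j),
    ∀ a ∈ range (p + 1), (#(part D m p g hij w f a) : ℝ) ≤ 4 * (m / (g : ℝ) ^ (k - 1)) + σ

theorem unifProb_not_splitGood_le {D : DB k n} {m p g : ℕ} (hm : 0 < m) (hD : ∀ j, #(D j) = m)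
    (hg : 1 ≤ g) (hgp : g ^ k ≤ p) (σ : ℝ) (w₀ : Fin k → Fin n) :
    unifProb (fun f => ¬ SplitGood D m p g σ w₀ f) ≤
      (k : ℝ) ^ 2 * (p * (p + 1)) * Real.exp (-σ) := by
  have h1 : ∀ x : Fin k × Fin k, unifProb (fun f : Fin n → Fin (p + 1) => ∃ hij : x.2 ≠ x.1,
      ∃ w ∈ frequentPatterns D m p w₀ x.1 ((univ.erase x.1).erase x.2), ∃ a ∈ range (p + 1),
        4 * (m / (g : ℝ) ^ (k - 1)) + σ < #(part D m p g hij w f a)) ≤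
      p * ((p + 1) * Real.exp (-σ)) := by
    intro x
    by_cases hx : x.2 ≠ x.1
    · refine (unifProb_mono (F := fun f : Fin n → Fin (p + 1) =>
        ∃ w ∈ frequentPatterns D m p w₀ x.1 ((univ.erase x.1).erase x.2), ∃ a ∈ range (p + 1),
          4 * (m / (g : ℝ) ^ (k - 1)) + σ < #(part D m p g hx w f a)) fun h hh => hh.2).trans ?_
      refine (unifProb_exists_le _ _ fun w hw => unifProb_exists_le _ _ fun a _ =>
        unifProb_part_le hm hD hg hgp hx w a σ).trans ?_
      have hw : (#(frequentPatterns D m p w₀ x.1 ((univ.erase x.1).erase x.2)) : ℝ) ≤ p := by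
        exact_mod_cast card_frequentPatterns_le hm hD p w₀ (by simp)
      rw [card_range]
      push_cast
      gcongr
    · refine (unifProb_mono (F := fun _ => False) fun h hh => hx hh.1).trans ?_
      simp only [unifProb, filter_false, card_empty, Nat.cast_zero, zero_div]
      positivity
  refine (unifProb_mono (F := fun f => ∃ x ∈ (univ : Finset (Fin k × Fin k)), ∃ hij : x.2 ≠ x.1,
      ∃ w ∈ frequentPatterns D m p w₀ x.1 ((univ.erase x.1).erase x.2), ∃ a ∈ range (p + 1),
        4 * (m / (g : ℝ) ^ (k - 1)) + σ < #(part D m p g hij w f a)) fun f hf => ?_).trans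
    ((unifProb_exists_le _ _ fun x _ => h1 x).trans (le_of_eq ?_))
  · unfold SplitGood at hf
    push Not at hf
    obtain ⟨i, j, hij, w, hw, a, ha, ho⟩ := hf
    exact ⟨(i, j), mem_univ _, hij, w, hw, a, ha, ho⟩
  · simp only [card_univ, Fintype.card_prod, Fintype.card_fin]
    push_cast
    ring

/-! ### Hash keys of candidates and the size of their groups. -/

/-- The part to which the candidate `t` belongs among those with the same restriction to the
attributes of `S_j`. -/
noncomputable def slot {p : ℕ} (d : Fin k → Finset (Fin k) → (Fin k → Fin n) → ℕ) (m g : ℕ)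
    (f : Fin n → Fin (p + 1)) (i j : Fin k) (U : Finset (Fin k)) (t : Fin k → Fin n) :
    Fin (p + 1) :=
  ⟨(f (t j)).1 % copies d m g i j U t, (Nat.mod_le _ _).trans_lt (f (t j)).2⟩

abbrev Key (k n p : ℕ) : Type := (ConjunctiveQuery.loomisWhitney k).Fact n × Fin (p + 1)

/-- The key by which the candidate `t` is hashed for the comparison of `S_i` and `S_j`. -/
noncomputable def key {p : ℕ} (d : Fin k → Finset (Fin k) → (Fin k → Fin n) → ℕ) (m g : ℕ)
    (f : Fin n → Fin (p + 1)) (i j : Fin k) (U : Finset (Fin k)) (t : Fin k → Fin n) : Key k n p :=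
  (⟨j, res j t⟩, slot d m g f i j U t)

/-- The degrees that can be read off from the statistics on `D`. -/
noncomputable def statDeg (p : ℕ) (D : DB k n) : Fin k → Finset (Fin k) → (Fin k → Fin n) → ℕ :=
  knownDeg ((ConjunctiveQuery.loomisWhitney k).heavyHitters p D)

theorem statDeg_le {D : DB k n} {m : ℕ} (hD : ∀ j, #(D j) = m) (p : ℕ) (l : Fin k)
    (V : Finset (Fin k)) (t : Fin k → Fin n) : statDeg p D l V t ≤ deg D l V t := by
  rw [statDeg, knownDeg_eq hD]
  split_ifs <;> simp

theorem one_le_ratio {m p g : ℕ} (hg : 1 ≤ g) (hgp : g ^ k ≤ p) (hpm : p ≤ m) :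
    (1 : ℝ) ≤ m / (g : ℝ) ^ (k - 1) := by
  have hg0 : (0 : ℝ) < g := by exact_mod_cast hg
  rw [le_div_iff₀ (by positivity), one_mul]
  exact_mod_cast (pow_card_le hg hgp (Nat.sub_le _ _)).trans hpm

theorem div_le_ratio {m p g : ℕ} (hg : 1 ≤ g) (hgp : g ^ k ≤ p) :
    (m : ℝ) / p ≤ m / (g : ℝ) ^ (k - 1) := by
  have hg0 : (0 : ℝ) < g := by exact_mod_cast hg
  gcongr
  exact_mod_cast pow_card_le hg hgp (Nat.sub_le _ _)

/-- Bounds the weight of one key in the Chernoff bound for candidates. For `j ∈ U` minimality does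
it, with `g ≤ L` from `g^k ≤ p ≤ m`. For `j ∉ U` a frequent pattern has been split into slots, and
an infrequent one has at most `m / p ≤ L` extensions. -/
theorem card_group_le {D : DB k n} {m p g : ℕ} (hm : 0 < m) (hD : ∀ j, #(D j) = m) (hk : 1 ≤ k)
    (hg : 1 ≤ g) (hgp : g ^ k ≤ p) (hpm : p ≤ m) {σ : ℝ} (hσ : 0 ≤ σ) {w₀ : Fin k → Fin n}
    {f : Fin n → Fin (p + 1)} (hf : SplitGood D m p g σ w₀ f) {i j : Fin k} {U : Finset (Fin k)}
    (hij : j ≠ i) (b : Key k n p) (A : Finset (Fin k → Fin n)) (hA : A ⊆ cand D m g i U)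
    (hb : ∀ t ∈ A, key (statDeg p D) m g f i j U t = b) :
    (#A : ℝ) ≤ (k + 4 + σ) * (m / (g : ℝ) ^ (k - 1)) := by
  have hg0 : (0 : ℝ) < g := by exact_mod_cast hg
  have hL := one_le_ratio hg hgp hpm
  set L := (m : ℝ) / (g : ℝ) ^ (k - 1) with hLdef
  have hp : 0 < p := (pow_card_le hg hgp (N := 0) (by omega))
  rcases A.eq_empty_or_nonempty with rfl | ⟨t₀, ht₀⟩
  · simp only [card_empty, Nat.cast_zero]; positivity
  have hmem : ∀ t ∈ A, MinHeavy (deg D) m g U t ∧ res i t ∈ D i := fun t ht =>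
    (mem_filter.1 (hA ht)).2
  have hres : ∀ t ∈ A, res j t = res j t₀ := by
    intro t ht
    have h1 := congrArg Prod.fst ((hb t ht).trans (hb t₀ ht₀).symm)
    simp only [key, Sigma.mk.injEq, heq_eq_eq, true_and] at h1
    exact h1
  by_cases hj : j ∈ U
  · have h1 : #A ≤ k * g := by
      refine le_trans (card_le_card fun t ht => ?_) (card_minHeavy_fiber_le (D := D) hm hj (res j t₀))
      exact mem_filter.2 ⟨mem_univ _, (hmem t ht).1, hres t ht⟩
    have h2 : (g : ℝ) ≤ L := by
      rw [hLdef, le_div_iff₀ (by positivity), ← pow_succ', Nat.sub_add_cancel hk]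
      exact_mod_cast hgp.trans hpm
    calc (#A : ℝ) ≤ k * g := by exact_mod_cast h1
      _ ≤ k * L := by gcongr
      _ ≤ (k + 4 + σ) * L := by gcongr; linarith
  · set W : Finset (Fin k) := (univ.erase i).erase j with hW
    have hagW : ∀ t ∈ A, ∀ a ∈ W, t a = t₀ a := fun t ht a ha =>
      res_eq_iff.1 (hres t ht) a (ne_of_mem_erase ha)
    have hinj : Set.InjOn (res i) (A : Set (Fin k → Fin n)) := by
      intro t ht t' ht' e
      exact eq_of_res_eq ((hres t ht).trans (hres t' ht').symm) (res_eq_iff.1 e j hij)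
    have hiW : i ∉ W := by simp [hW]
    by_cases hfr : m < p * deg D i W t₀
    · obtain ⟨w, hw, hag⟩ := exists_frequentPattern w₀ hfr
      -- For a frequent pattern the recorded degree is the true one, so slots are exactly the parts
      -- controlled by `SplitGood`.
      have hdeg : ∀ t ∈ A, copies (statDeg p D) m g i j U t = parts D m g i j w := by
        intro t ht
        have e1 : deg D i W t = deg D i W w := deg_congr D i fun a ha =>
          (hagW t ht a ha).trans (hag a ha)
        have e0 : deg D i W t = deg D i W t₀ := deg_congr D i (hagW t ht)
        rw [copies, if_neg hj, parts, statDeg, knownDeg_eq hD, if_pos (by rw [← hW, e0]; exact hfr),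
          ← hW, e1]
      have h1 := hf i j hij w hw b.2.1 (mem_range.2 b.2.2)
      refine le_trans (le_trans ?_ h1) ?_
      · norm_cast
        refine card_le_card_of_injOn (res i) (fun t ht => ?_) hinj
        simp only [part, coe_filter, Set.mem_ofPred_eq]
        refine ⟨(hmem t ht).2, (agree_res hiW).2 fun a ha => (hagW t ht a ha).trans (hag a ha), ?_⟩
        have h2 := congrArg (fun x => x.2.1) (hb t ht)
        simp only [key, slot] at h2
        rw [hdeg t ht] at h2
        exact h2
      · have hk0 : (0 : ℝ) ≤ k := by positivity
        nlinarith
    · have h1 : #A ≤ deg D i W t₀ := by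
        refine card_le_card_of_injOn (res i) (fun t ht => ?_) hinj
        simp only [coe_filter, Set.mem_ofPred_eq]
        exact ⟨(hmem t ht).2, (agree_res hiW).2 (hagW t ht)⟩
      have hp0 : (0 : ℝ) < p := by exact_mod_cast hp
      have h2 : (deg D i W t₀ : ℝ) ≤ m / p := by
        rw [le_div_iff₀ hp0, mul_comm]
        exact_mod_cast not_lt.1 hfr
      have h3 := div_le_ratio (m := m) hg hgp
      have hk0 : (0 : ℝ) ≤ k := by positivity
      calc (#A : ℝ) ≤ deg D i W t₀ := by exact_mod_cast h1
        _ ≤ L := h2.trans h3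
        _ ≤ (k + 4 + σ) * L := le_mul_of_one_le_left (by linarith) (by linarith)

/-! ### The good events for the servers and their probabilities. -/

/-- The keys at which the tuples of `S_j` are needed. -/
noncomputable def checks (D : DB k n) (m p g : ℕ) (i j : Fin k) (U : Finset (Fin k)) :
    Finset (Tup k n j × Fin (p + 1)) :=
  {x ∈ D j ×ˢ (univ : Finset (Fin (p + 1))) | ∃ t, MinHeavy (deg D) m g U t ∧ res j t = x.1 ∧
      x.2.1 < copies (statDeg p D) m g i j U t}

/-- No server receives too many candidates for the comparison of two relations. -/
def GroupsGood (D : DB k n) (m p g : ℕ) (σ : ℝ) (f : Fin n → Fin (p + 1))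
    (f₂ : Key k n p → Fin p) : Prop :=
  ∀ x : Fin k × Fin k × Finset (Fin k) × Fin p, x.1 ∈ x.2.2.1 → x.2.1 ≠ x.1 →
    (#{t ∈ cand D m g x.1 x.2.2.1 | f₂ (key (statDeg p D) m g f x.1 x.2.1 x.2.2.1 t) = x.2.2.2} : ℝ)
      ≤ 2 * (1 / p) * (k * (g * m)) + σ * ((k + 4 + σ) * (m / (g : ℝ) ^ (k - 1)))

/-- No server receives too many tuples against which candidates are checked. -/
def ChecksGood (D : DB k n) (m p g : ℕ) (σ : ℝ) (f₂ : Key k n p → Fin p) : Prop :=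
  ∀ x : Fin k × Fin k × Finset (Fin k) × Fin p, x.1 ∈ x.2.2.1 → x.2.1 ≠ x.1 →
    (#{y ∈ checks D m p g x.1 x.2.1 x.2.2.1 | f₂ (⟨x.2.1, y.1⟩, y.2) = x.2.2.2} : ℝ)
      ≤ 2 * (1 / p) * ((k + 1) * m) + σ * 1

/-- No server receives too many candidates in the second round. -/
def CollectGood (D : DB k n) (m p g : ℕ) (σ : ℝ) (f₃ : (Fin k → Fin n) → Fin p) : Prop :=
  ∀ x : Fin k × Fin k × Finset (Fin k) × Fin p, x.1 ∈ x.2.2.1 →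
    (#{t ∈ cand D m g x.1 x.2.2.1 | f₃ t = x.2.2.2} : ℝ) ≤ 2 * (1 / p) * (k * (g * m)) + σ * 1

theorem unifProb_hash_server {τ β : Type*} [Fintype β] [DecidableEq β] {p : ℕ} (hp : 0 < p)
    (A : Finset τ) (κ : τ → β) {B T : ℝ} (hB : 0 < B)
    (hκ : ∀ b, ∀ A' ⊆ A, (∀ t ∈ A', κ t = b) → (#A' : ℝ) ≤ B) (hT : (#A : ℝ) ≤ T) (σ : ℝ)
    (s : Fin p) :
    unifProb (fun h : β → Fin p => ¬ (#{t ∈ A | h (κ t) = s} : ℝ) ≤ 2 * (1 / p) * T + σ * B) ≤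
      Real.exp (-σ) := by
  have hp0 : (p : ℝ) ≠ 0 := by exact_mod_cast hp.ne'
  have : Nonempty (Fin p) := ⟨s⟩
  have hS : (#({s} : Finset (Fin p)) : ℝ) ≤ 1 / (p : ℝ) * Fintype.card (Fin p) := by simp [hp0]
  refine le_trans (unifProb_mono fun h hh => ?_) (unifProb_hash A κ {s} hS hB hκ hT σ)
  exact ⟨_, filter_subset _ _, fun t ht => mem_singleton.2 (mem_filter.1 ht).2, not_le.1 hh⟩

theorem unifProb_exists_index_le {Ω : Type*} [Fintype Ω] {p : ℕ}
    (E : Fin k × Fin k × Finset (Fin k) × Fin p → Ω → Prop) {δ : ℝ} (h : ∀ x, unifProb (E x) ≤ δ) :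
    unifProb (fun ω => ∃ x, E x ω) ≤ (k : ℝ) ^ 2 * 2 ^ k * p * δ := by
  refine (unifProb_mono (F := fun ω => ∃ x ∈ (univ : Finset (Fin k × Fin k × Finset (Fin k) ×
    Fin p)), E x ω) (by simp)).trans ((unifProb_exists_le _ _ fun x _ => h x).trans (le_of_eq ?_))
  simp only [card_univ, Fintype.card_prod, Fintype.card_fin, Fintype.card_finset]
  push_cast
  ring

theorem unifProb_imp_le {Ω : Type*} [Fintype Ω] {c : Prop} {E : Ω → Prop} {δ : ℝ} (hδ : 0 ≤ δ)
    (h : c → unifProb (fun ω => ¬ E ω) ≤ δ) : unifProb (fun ω => ¬ (c → E ω)) ≤ δ := by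
  by_cases hc : c
  · refine le_trans (unifProb_mono fun ω hω => ?_) (h hc)
    exact fun hE => hω fun _ => hE
  · refine le_trans (unifProb_mono (F := fun _ => False) fun ω hω => hω fun h => (hc h).elim) ?_
    simpa [unifProb] using hδ

/-- Here `f` is fixed and only the independent `f₂` is random, so the group bound supplied by
`SplitGood` is deterministic. -/
theorem unifProb_not_groupsGood_le {D : DB k n} {m p g : ℕ} (hm : 0 < m) (hD : ∀ j, #(D j) = m)
    (hk : 1 ≤ k) (hg : 1 ≤ g) (hgp : g ^ k ≤ p) (hpm : p ≤ m) {σ : ℝ} (hσ : 0 ≤ σ)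
    {w₀ : Fin k → Fin n} {f : Fin n → Fin (p + 1)} (hf : SplitGood D m p g σ w₀ f) :
    unifProb (fun f₂ => ¬ GroupsGood D m p g σ f f₂) ≤
      (k : ℝ) ^ 2 * 2 ^ k * p * Real.exp (-σ) := by
  have hL := one_le_ratio hg hgp hpm
  have hp : 0 < p := (pow_card_le hg hgp (N := 0) (by omega))
  simp only [GroupsGood, not_forall (p := fun x : Fin k × Fin k × Finset (Fin k) × Fin p => _)]
  refine unifProb_exists_index_le _ fun x => unifProb_imp_le (Real.exp_pos _).le fun hi =>
    unifProb_imp_le (Real.exp_pos _).le fun hij => ?_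
  refine unifProb_hash_server hp _ (key (statDeg p D) m g f x.1 x.2.1 x.2.2.1) ?_
    (card_group_le hm hD hk hg hgp hpm hσ hf hij) ?_ σ x.2.2.2
  · have hk0 : (0 : ℝ) ≤ k := by positivity
    exact mul_pos (by linarith) (by linarith)
  · exact_mod_cast card_cand_le hm hD hi

theorem unifProb_not_checksGood_le {D : DB k n} {m p g : ℕ} (hm : 0 < m) (hD : ∀ j, #(D j) = m)
    (hk : 1 ≤ k) (hg : 1 ≤ g) (hgp : g ^ k ≤ p) (hpm : p ≤ m) (σ : ℝ) :
    unifProb (fun f₂ : Key k n p → Fin p => ¬ ChecksGood D m p g σ f₂) ≤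
      (k : ℝ) ^ 2 * 2 ^ k * p * Real.exp (-σ) := by
  have hp : 0 < p := (pow_card_le hg hgp (N := 0) (by omega))
  simp only [ChecksGood, not_forall (p := fun x : Fin k × Fin k × Finset (Fin k) × Fin p => _)]
  refine unifProb_exists_index_le _ fun x => unifProb_imp_le (Real.exp_pos _).le fun hi =>
    unifProb_imp_le (Real.exp_pos _).le fun hij => ?_
  refine unifProb_hash_server hp (checks D m p g x.1 x.2.1 x.2.2.1)
    (fun y => ((⟨x.2.1, y.1⟩, y.2) : Key k n p)) one_pos (fun b A' hA' hb => ?_) ?_ σ x.2.2.2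
  · norm_cast
    refine card_le_one.2 fun y hy z hz => ?_
    have h := (hb y hy).trans (hb z hz).symm
    simp only [Prod.mk.injEq, Sigma.mk.injEq, heq_eq_eq, true_and] at h
    exact Prod.ext h.1 h.2
  · exact_mod_cast card_copies_le hm hD hk (hgp.trans hpm) hij hi (statDeg_le hD p)

theorem unifProb_not_collectGood_le {D : DB k n} {m p g : ℕ} (hm : 0 < m) (hD : ∀ j, #(D j) = m)
    (hg : 1 ≤ g) (hgp : g ^ k ≤ p) (σ : ℝ) :
    unifProb (fun f₃ : (Fin k → Fin n) → Fin p => ¬ CollectGood D m p g σ f₃) ≤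
      (k : ℝ) ^ 2 * 2 ^ k * p * Real.exp (-σ) := by
  have hp : 0 < p := (pow_card_le hg hgp (N := 0) (by omega))
  simp only [CollectGood, not_forall (p := fun x : Fin k × Fin k × Finset (Fin k) × Fin p => _)]
  refine unifProb_exists_index_le _ fun x => unifProb_imp_le (Real.exp_pos _).le fun hi => ?_
  refine unifProb_hash_server hp _ (fun t => t) one_pos (fun b A' hA' hb => ?_) ?_ σ x.2.2.2
  · norm_cast
    exact card_le_one.2 fun y hy z hz => (hb y hy).trans (hb z hz).symm
  · exact_mod_cast card_cand_le hm hD hi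

abbrev Coins (k n p g : ℕ) : Type :=
  (Fin k → Fin n → Fin g) × (Fin n → Fin (p + 1)) × (Key k n p → Fin p) ×
    ((Fin k → Fin n) → Fin p)

def Good (D : DB k n) (m p g : ℕ) (σ : ℝ) (w₀ : Fin k → Fin n) (ω : Coins k n p g) : Prop :=
  CellsGood D m p g σ w₀ ω.1 ∧ SplitGood D m p g σ w₀ ω.2.1 ∧ GroupsGood D m p g σ ω.2.1 ω.2.2.1 ∧
    ChecksGood D m p g σ ω.2.2.1 ∧ CollectGood D m p g σ ω.2.2.2

theorem unifProb_not_good_le {D : DB k n} {m p g : ℕ} (hm : 0 < m) (hD : ∀ j, #(D j) = m)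
    (hk : 1 ≤ k) (hg : 1 ≤ g) (hgp : g ^ k ≤ p) (hpm : p ≤ m) {σ : ℝ} (hσ : 0 ≤ σ)
    (w₀ : Fin k → Fin n) :
    unifProb (fun ω : Coins k n p g => ¬ Good D m p g σ w₀ ω) ≤
      6 * (k : ℝ) ^ 2 * 4 ^ k * p ^ 2 * Real.exp (-σ) := by
  have hp : 0 < p := (pow_card_le hg hgp (N := 0) (by omega))
  have hp1 : (1 : ℝ) ≤ p := by exact_mod_cast hp
  set ε := Real.exp (-σ) with hε
  have hε0 : 0 < ε := Real.exp_pos _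
  have h1 : unifProb (fun ω : Coins k n p g => ¬ CellsGood D m p g σ w₀ ω.1) ≤
      (k : ℝ) ^ 2 * 4 ^ k * p ^ 2 * ε :=
    unifProb_prod_left (by positivity) fun _ => unifProb_not_cellsGood_le hm hD hg hgp hσ w₀
  have h2 : unifProb (fun ω : Coins k n p g => ¬ SplitGood D m p g σ w₀ ω.2.1) ≤
      (k : ℝ) ^ 2 * (p * (p + 1)) * ε :=
    unifProb_prod_right (by positivity) fun _ => unifProb_prod_left (by positivity) fun _ =>
      unifProb_not_splitGood_le hm hD hg hgp σ w₀
  -- As an implication, the event is improbable for every `f`; for a bad split it cannot fail.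
  have h3' : ∀ f : Fin n → Fin (p + 1), unifProb (fun f₂ : Key k n p → Fin p =>
      ¬ (SplitGood D m p g σ w₀ f → GroupsGood D m p g σ f f₂)) ≤
        (k : ℝ) ^ 2 * 2 ^ k * p * ε := fun f =>
    unifProb_imp_le (E := fun f₂ => GroupsGood D m p g σ f f₂) (by positivity) fun hf =>
      unifProb_not_groupsGood_le hm hD hk hg hgp hpm hσ hf
  have h3 : unifProb (fun ω : Coins k n p g => ¬ (SplitGood D m p g σ w₀ ω.2.1 →
      GroupsGood D m p g σ ω.2.1 ω.2.2.1)) ≤ (k : ℝ) ^ 2 * 2 ^ k * p * ε :=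
    unifProb_prod_right (by positivity) fun _ => unifProb_prod_right (by positivity) fun f =>
      unifProb_prod_left (by positivity) fun _ => h3' f
  have h4 : unifProb (fun ω : Coins k n p g => ¬ ChecksGood D m p g σ ω.2.2.1) ≤
      (k : ℝ) ^ 2 * 2 ^ k * p * ε :=
    unifProb_prod_right (by positivity) fun _ => unifProb_prod_right (by positivity) fun f =>
      unifProb_prod_left (by positivity) fun _ =>
        unifProb_not_checksGood_le hm hD hk hg hgp hpm σ
  have h5 : unifProb (fun ω : Coins k n p g => ¬ CollectGood D m p g σ ω.2.2.2) ≤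
      (k : ℝ) ^ 2 * 2 ^ k * p * ε :=
    unifProb_prod_right (by positivity) fun _ => unifProb_prod_right (by positivity) fun f =>
      unifProb_prod_right (by positivity) fun _ => unifProb_not_collectGood_le hm hD hg hgp σ
  have h6 : unifProb (fun ω : Coins k n p g => ¬ Good D m p g σ w₀ ω) ≤
      (k : ℝ) ^ 2 * 4 ^ k * p ^ 2 * ε + ((k : ℝ) ^ 2 * (p * (p + 1)) * ε +
        ((k : ℝ) ^ 2 * 2 ^ k * p * ε + ((k : ℝ) ^ 2 * 2 ^ k * p * ε +
          (k : ℝ) ^ 2 * 2 ^ k * p * ε))) := by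
    refine le_trans (unifProb_mono fun ω hω => ?_) ((unifProb_or_le _ _).trans (add_le_add h1
      ((unifProb_or_le _ _).trans (add_le_add h2 ((unifProb_or_le _ _).trans (add_le_add h3
        ((unifProb_or_le _ _).trans (add_le_add h4 h5))))))))
    unfold Good at hω
    tauto
  refine h6.trans ?_
  have e2 : (2 : ℝ) ^ k ≤ 4 ^ k := by gcongr; norm_num
  have e1 : (1 : ℝ) ≤ 4 ^ k := one_le_pow₀ (by norm_num)
  have e3 : (p : ℝ) ≤ p ^ 2 := by nlinarith
  have e4 : (p : ℝ) * (p + 1) ≤ 2 * p ^ 2 := by nlinarith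
  have b1 : (k : ℝ) ^ 2 * 2 ^ k * p * ε ≤ (k : ℝ) ^ 2 * 4 ^ k * p ^ 2 * ε := by gcongr
  have b2 : (k : ℝ) ^ 2 * (p * (p + 1)) * ε ≤ 2 * ((k : ℝ) ^ 2 * 4 ^ k * p ^ 2 * ε) := by
    calc (k : ℝ) ^ 2 * (p * (p + 1)) * ε ≤ (k : ℝ) ^ 2 * (2 * p ^ 2) * ε :=
          mul_le_mul_of_nonneg_right (mul_le_mul_of_nonneg_left e4 (by positivity)) hε0.le
      _ = 2 * ((k : ℝ) ^ 2 * 1 * p ^ 2 * ε) := by ring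
      _ ≤ _ := by gcongr
  linarith

/-! ### The two-round scheme and its correctness. -/

abbrev Item (k n : ℕ) : Type := Fin k × Fin k × Finset (Fin k) × (Fin k → Fin n)

/-- Tuples without heavy patterns are found by the hypercube algorithm in the first round; here
`code` enumerates the cells. A tuple `t` with a minimal heavy pattern on `U` is handled for every
`i ∈ U`: in the first round, `t` is checked against `S_i` and `S_j` for every `j ≠ i`, and the
outcomes are collected in the second round. -/
noncomputable def scheme (k n m : ℕ) {p g : ℕ} (hp : 0 < p) (hg : 1 ≤ g)
    (code : (Fin k → Fin g) → Fin p) :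
    TwoRoundScheme (ConjunctiveQuery.loomisWhitney k) n p (Item k n) where
  Seed := Coins k n p g
  seedNonempty := ⟨(fun _ _ => ⟨0, hg⟩, fun _ => 0, fun _ => ⟨0, hp⟩, fun _ => ⟨0, hp⟩)⟩
  route ω st f s := ∃ t, res f.1 t = f.2 ∧
    (((∀ U, ¬ Heavy (knownDeg st) m g U t) ∧ code (fun i => ω.1 i (t i)) = s) ∨
      ∃ i j U, i ∈ U ∧ j ≠ i ∧ (f.1 = i ∨ f.1 = j) ∧ MinHeavy (knownDeg st) m g U t ∧
        ω.2.2.1 (key (knownDeg st) m g ω.2.1 i j U t) = s)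
  forward ω st s' R x s :=
    (x.1 ∈ x.2.2.1 ∧ x.2.1 ≠ x.1 ∧ MinHeavy (knownDeg st) m g x.2.2.1 x.2.2.2) ∧
      (⟨x.1, res x.1 x.2.2.2⟩ : (ConjunctiveQuery.loomisWhitney k).Fact n) ∈ R ∧
      (⟨x.2.1, res x.2.1 x.2.2.2⟩ : (ConjunctiveQuery.loomisWhitney k).Fact n) ∈ R ∧
      ω.2.2.1 (key (knownDeg st) m g ω.2.1 x.1 x.2.1 x.2.2.1 x.2.2.2) = s' ∧ ω.2.2.2 x.2.2.2 = s
  out _ _ R Y := {t | (∀ l, (⟨l, res l t⟩ : (ConjunctiveQuery.loomisWhitney k).Fact n) ∈ R) ∨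
    ∃ i U, ∀ j, j ≠ i → (i, j, U, t) ∈ Y}

theorem mem_facts {D : DB k n} {l : Fin k} {u : Tup k n l} :
    (⟨l, u⟩ : (ConjunctiveQuery.loomisWhitney k).Fact n) ∈
      (ConjunctiveQuery.loomisWhitney k).facts D ↔ u ∈ D l := by
  simp [ConjunctiveQuery.facts]

theorem mem_answers {D : DB k n} {t : Fin k → Fin n} :
    t ∈ (ConjunctiveQuery.loomisWhitney k).answers D ↔ ∀ j, res j t ∈ D j := by
  simp only [ConjunctiveQuery.answers, mem_filter, mem_univ, true_and]
  rfl

theorem mem_first {m p g : ℕ} (hp : 0 < p) (hg : 1 ≤ g) (code : (Fin k → Fin g) → Fin p)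
    (ω : Coins k n p g) (D : DB k n) (s : Fin p) {l : Fin k} {u : Tup k n l} :
    (⟨l, u⟩ : (ConjunctiveQuery.loomisWhitney k).Fact n) ∈
      (scheme k n m hp hg code).first ω D s ↔ u ∈ D l ∧ ∃ t, res l t = u ∧
      (((∀ U, ¬ Heavy (statDeg p D) m g U t) ∧ code (fun i => ω.1 i (t i)) = s) ∨
      ∃ i j U, i ∈ U ∧ j ≠ i ∧ (l = i ∨ l = j) ∧ MinHeavy (statDeg p D) m g U t ∧
        ω.2.2.1 (key (statDeg p D) m g ω.2.1 i j U t) = s) := by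
  unfold TwoRoundScheme.first
  rw [mem_filter, mem_facts]
  rfl

theorem mem_sent {m p g : ℕ} (hp : 0 < p) (hg : 1 ≤ g) (code : (Fin k → Fin g) → Fin p)
    (ω : Coins k n p g) (D : DB k n) (s' s : Fin p) {x : Item k n} :
    x ∈ (scheme k n m hp hg code).sent ω D s' s ↔
    (x.1 ∈ x.2.2.1 ∧ x.2.1 ≠ x.1 ∧ MinHeavy (statDeg p D) m g x.2.2.1 x.2.2.2) ∧
      (⟨x.1, res x.1 x.2.2.2⟩ : (ConjunctiveQuery.loomisWhitney k).Fact n) ∈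
        (scheme k n m hp hg code).first ω D s' ∧
      (⟨x.2.1, res x.2.1 x.2.2.2⟩ : (ConjunctiveQuery.loomisWhitney k).Fact n) ∈
        (scheme k n m hp hg code).first ω D s' ∧
      ω.2.2.1 (key (statDeg p D) m g ω.2.1 x.1 x.2.1 x.2.2.1 x.2.2.2) = s' ∧
        ω.2.2.2 x.2.2.2 = s := by
  unfold TwoRoundScheme.sent
  rw [mem_filter]
  simp only [mem_univ, true_and]
  rfl

/-- Soundness holds because servers receive only true facts and forward an item only after seeing
both its facts. An answer is found either at its hypercube cell or, through a minimal heavy pattern,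
at the server `ω.2.2.2 t`; no property of the hash functions is needed. -/
theorem scheme_correct (hk : 2 ≤ k) {D : DB k n} {m p g : ℕ} (hD : ∀ j, #(D j) = m) (hp : 0 < p)
    (hg : 1 ≤ g) (hgp : g ^ k ≤ p) (code : (Fin k → Fin g) → Fin p) (ω : Coins k n p g) :
    (univ.biUnion fun s => (scheme k n m hp hg code).out ω
      ((ConjunctiveQuery.loomisWhitney k).heavyHitters p D) ((scheme k n m hp hg code).first ω D s)
      (univ.biUnion fun s' => (scheme k n m hp hg code).sent ω D s' s)) =
    (ConjunctiveQuery.loomisWhitney k).answers D := by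
  have hout : ∀ s t, t ∈ (scheme k n m hp hg code).out ω
      ((ConjunctiveQuery.loomisWhitney k).heavyHitters p D) ((scheme k n m hp hg code).first ω D s)
      (univ.biUnion fun s' => (scheme k n m hp hg code).sent ω D s' s) ↔
      (∀ l, (⟨l, res l t⟩ : (ConjunctiveQuery.loomisWhitney k).Fact n) ∈
        (scheme k n m hp hg code).first ω D s) ∨
      ∃ i U, ∀ j, j ≠ i → ∃ s', (i, j, U, t) ∈ (scheme k n m hp hg code).sent ω D s' s := by
    intro s t
    change t ∈ univ.filter _ ↔ _
    simp only [mem_filter, mem_univ, true_and, mem_biUnion]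
  ext t
  rw [mem_answers]
  simp only [mem_biUnion, mem_univ, true_and, hout]
  constructor
  · rintro ⟨s, h | ⟨i, U, h⟩⟩ l
    · exact ((mem_first hp hg code ω D s).1 (h l)).1
    · have : Nontrivial (Fin k) := Fin.nontrivial_iff_two_le.2 hk
      by_cases hl : l = i
      -- Membership in `S_i` is certified by any comparison with another relation, so some `j ≠ i`
      -- must exist.
      · obtain ⟨j, hj⟩ := exists_ne i
        obtain ⟨s', hs⟩ := h j hj
        have := ((mem_sent hp hg code ω D s' s).1 hs).2.1
        rw [hl]
        exact ((mem_first hp hg code ω D s').1 this).1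
      · obtain ⟨s', hs⟩ := h l hl
        have := ((mem_sent hp hg code ω D s' s).1 hs).2.2.1
        exact ((mem_first hp hg code ω D s').1 this).1
  · intro h
    by_cases hH : ∃ U, Heavy (statDeg p D) m g U t
    · obtain ⟨V, hV⟩ := hH
      obtain ⟨U, hU⟩ := exists_minHeavy _ _ _ hV
      have hne : U.Nonempty := by
        rw [nonempty_iff_ne_empty]
        rintro rfl
        have h0 := hU.1
        rw [statDeg, heavy_knownDeg hD hg hgp] at h0
        exact not_heavy_empty hD g t h0
      obtain ⟨i, hi⟩ := hne
      refine ⟨ω.2.2.2 t, Or.inr ⟨i, U, fun j hj => ⟨ω.2.2.1 (key (statDeg p D) m g ω.2.1 i j U t),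
        (mem_sent hp hg code ω D _ _).2 ⟨⟨hi, hj, hU⟩, ?_, ?_, rfl, rfl⟩⟩⟩⟩
      · exact (mem_first hp hg code ω D _).2
          ⟨h i, t, rfl, Or.inr ⟨i, j, U, hi, hj, Or.inl rfl, hU, rfl⟩⟩
      · exact (mem_first hp hg code ω D _).2
          ⟨h j, t, rfl, Or.inr ⟨i, j, U, hi, hj, Or.inr rfl, hU, rfl⟩⟩
    · push Not at hH
      exact ⟨code fun i => ω.1 i (t i), Or.inl fun l =>
        (mem_first hp hg code ω D _).2 ⟨h l, t, rfl, Or.inl ⟨hH, rfl⟩⟩⟩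

/-! ### Load bounds for good coins. -/

theorem card_biUnion_le_mul {ι τ : Type*} [DecidableEq τ] (S : Finset ι) (F : ι → Finset τ) {B : ℝ}
    (h : ∀ i ∈ S, (#(F i) : ℝ) ≤ B) : (#(S.biUnion F) : ℝ) ≤ #S * B := by
  calc (#(S.biUnion F) : ℝ) ≤ ((∑ i ∈ S, #(F i) : ℕ) : ℝ) := by exact_mod_cast card_biUnion_le
    _ = ∑ i ∈ S, (#(F i) : ℝ) := by push_cast; rfl
    _ ≤ _ := by rw [← nsmul_eq_mul]; exact sum_le_card_nsmul _ _ _ h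

theorem card_triples_le (S : Finset (Fin k × Fin k × Finset (Fin k))) :
    (#S : ℝ) ≤ (k : ℝ) ^ 2 * 2 ^ k := by
  calc (#S : ℝ) ≤ ((k * (k * 2 ^ k) : ℕ) : ℝ) := by
        exact_mod_cast (card_le_univ S).trans_eq (by simp)
    _ = _ := by push_cast; ring

theorem card_first_le {D : DB k n} {m p g : ℕ} (hD : ∀ j, #(D j) = m) (hp : 0 < p)
    (hg : 1 ≤ g) (hgp : g ^ k ≤ p) {code : (Fin k → Fin g) → Fin p}
    (hcode : Function.Injective code) {σ : ℝ} (hσ : 0 ≤ σ) {w₀ : Fin k → Fin n}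
    {ω : Coins k n p g} (hω : Good D m p g σ w₀ ω) (s : Fin p) :
    (#((scheme k n m hp hg code).first ω D s) : ℝ) ≤
      k * ((2 + σ) ^ (k - 1) * (m / (g : ℝ) ^ (k - 1))) + (k : ℝ) ^ 2 * 2 ^ k *
        ((2 * (1 / p) * (k * (g * m)) + σ * ((k + 4 + σ) * (m / (g : ℝ) ^ (k - 1)))) +
          (2 * (1 / p) * ((k + 1) * m) + σ * 1)) := by
  obtain ⟨hcell, -, hgroup, hcheck, -⟩ := hω
  have hheavy : Heavy (statDeg p D) m g = Heavy (deg D) m g := heavy_knownDeg hD hg hgp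
  have hmin : MinHeavy (statDeg p D) m g = MinHeavy (deg D) m g := by
    funext U t; unfold MinHeavy; rw [hheavy]
  -- Since `code` is injective, a server is responsible for at most one cell of the hypercube.
  let light : Fin k → Finset ((ConjunctiveQuery.loomisWhitney k).Fact n) := fun l =>
    if h : ∃ c, code c = s then
      ({u ∈ lightPart D m g l | ∀ i : (ConjunctiveQuery.loomisWhitney k).Attr l,
        ω.1 i.1 (u i) = h.choose i.1} : Finset (Tup k n l)).image fun u => ⟨l, u⟩
    else ∅
  let heavy : Fin k × Fin k × Finset (Fin k) → Finset ((ConjunctiveQuery.loomisWhitney k).Fact n) :=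
    fun x => ({t ∈ cand D m g x.1 x.2.2 | ω.2.2.1 (key (statDeg p D) m g ω.2.1 x.1 x.2.1 x.2.2 t) = s} :
      Finset (Fin k → Fin n)).image (fun t => ⟨x.1, res x.1 t⟩) ∪
      ({y ∈ checks D m p g x.1 x.2.1 x.2.2 | ω.2.2.1 (⟨x.2.1, y.1⟩, y.2) = s} :
        Finset (Tup k n x.2.1 × Fin (p + 1))).image fun y => ⟨x.2.1, y.1⟩
  have hsub : (scheme k n m hp hg code).first ω D s ⊆ univ.biUnion light ∪
      (univ.filter fun x : Fin k × Fin k × Finset (Fin k) => x.1 ∈ x.2.2 ∧ x.2.1 ≠ x.1).biUnion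
        heavy := by
    rintro ⟨l, u⟩ hu
    obtain ⟨huD, t, htu, ⟨ht, hs⟩ | ⟨i, j, U, hi, hij, hl, ht, hs⟩⟩ :=
      (mem_first hp hg code ω D s).1 hu
    · refine mem_union_left _ (mem_biUnion.2 ⟨l, mem_univ _, ?_⟩)
      have hex : ∃ c, code c = s := ⟨_, hs⟩
      simp only [light, dif_pos hex]
      refine mem_image.2 ⟨u, mem_filter.2 ⟨mem_filter.2 ⟨huD, t, htu, ?_⟩, fun a => ?_⟩, rfl⟩
      · rwa [hheavy] at ht
      · rw [← hcode (hs.trans hex.choose_spec.symm), ← htu]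
        rfl
    · rw [hmin] at ht
      refine mem_union_right _ (mem_biUnion.2 ⟨(i, j, U), by simp [hi, hij], ?_⟩)
      rcases hl with rfl | rfl
      · refine mem_union_left _ (mem_image.2 ⟨t, mem_filter.2 ⟨?_, hs⟩, by rw [← htu]⟩)
        exact mem_filter.2 ⟨mem_univ _, ht, htu ▸ huD⟩
      · refine mem_union_right _ (mem_image.2 ⟨(u, slot (statDeg p D) m g ω.2.1 i l U t),
          mem_filter.2 ⟨mem_filter.2 ⟨mem_product.2 ⟨huD, mem_univ _⟩, t, ht, htu, ?_⟩, ?_⟩, rfl⟩)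
        · exact Nat.mod_lt _ (copies_pos _ _ _ _ _ _ _)
        · rw [← hs, key, htu]
  have hg0 : (0 : ℝ) < g := by exact_mod_cast hg
  have h1 := card_biUnion_le_mul (univ : Finset (Fin k)) light
    (B := (2 + σ) ^ (k - 1) * (m / (g : ℝ) ^ (k - 1))) fun l _ => by
      simp only [light]
      split_ifs with h
      · refine le_trans ?_ (card_hypercube_le hg hgp hσ hcell l h.choose)
        exact_mod_cast card_image_le
      · simp only [card_empty, Nat.cast_zero]; positivity
  have h2 := card_biUnion_le_mul
    (univ.filter fun x : Fin k × Fin k × Finset (Fin k) => x.1 ∈ x.2.2 ∧ x.2.1 ≠ x.1) heavy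
    (B := (2 * (1 / p) * (k * (g * m)) + σ * ((k + 4 + σ) * (m / (g : ℝ) ^ (k - 1)))) +
          (2 * (1 / p) * ((k + 1) * m) + σ * 1)) fun x hx => by
      obtain ⟨hx1, hx2⟩ := (mem_filter.1 hx).2
      refine le_trans ?_ (add_le_add (hgroup (x.1, x.2.1, x.2.2, s) hx1 hx2)
        (hcheck (x.1, x.2.1, x.2.2, s) hx1 hx2))
      norm_cast
      exact (card_union_le _ _).trans (add_le_add card_image_le card_image_le)
  have h3 := Nat.cast_le (α := ℝ).2 ((card_le_card hsub).trans (card_union_le _ _))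
  rw [Nat.cast_add] at h3
  refine h3.trans (add_le_add (h1.trans_eq (by simp)) (h2.trans ?_))
  exact mul_le_mul_of_nonneg_right (card_triples_le _) (by positivity)

theorem sum_card_sent_le {D : DB k n} {m p g : ℕ} (hD : ∀ j, #(D j) = m) (hp : 0 < p)
    (hg : 1 ≤ g) (hgp : g ^ k ≤ p) {code : (Fin k → Fin g) → Fin p} {σ : ℝ} (hσ : 0 ≤ σ)
    {w₀ : Fin k → Fin n} {ω : Coins k n p g} (hω : Good D m p g σ w₀ ω) (s : Fin p) :
    ((∑ s', #((scheme k n m hp hg code).sent ω D s' s) : ℕ) : ℝ) ≤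
      (k : ℝ) ^ 2 * 2 ^ k * (2 * (1 / p) * (k * (g * m)) + σ * 1) := by
  have hcollect := hω.2.2.2.2
  have hheavy : Heavy (statDeg p D) m g = Heavy (deg D) m g := heavy_knownDeg hD hg hgp
  have hmin : MinHeavy (statDeg p D) m g = MinHeavy (deg D) m g := by
    funext U t; unfold MinHeavy; rw [hheavy]
  -- The key of an item determines its unique sender, so the sets sent by different servers are
  -- disjoint.
  rw [← card_biUnion]
  swap
  · intro a _ b _ hab
    rw [Function.onFun, disjoint_left]
    intro x hx hx'
    exact hab (((mem_sent hp hg code ω D a s).1 hx).2.2.2.1.symm.trans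
      ((mem_sent hp hg code ω D b s).1 hx').2.2.2.1)
  let coll : Fin k × Fin k × Finset (Fin k) → Finset (Item k n) := fun x =>
    ({t ∈ cand D m g x.1 x.2.2 | ω.2.2.2 t = s} : Finset (Fin k → Fin n)).image
      fun t => (x.1, x.2.1, x.2.2, t)
  have hsub : (univ.biUnion fun s' => (scheme k n m hp hg code).sent ω D s' s) ⊆
      (univ.filter fun x : Fin k × Fin k × Finset (Fin k) => x.1 ∈ x.2.2).biUnion coll := by
    intro x hx
    obtain ⟨s', -, hx⟩ := mem_biUnion.1 hx
    obtain ⟨⟨h1, -, h3⟩, h4, -, -, h5⟩ := (mem_sent hp hg code ω D s' s).1 hx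
    rw [hmin] at h3
    refine mem_biUnion.2 ⟨(x.1, x.2.1, x.2.2.1), mem_filter.2 ⟨mem_univ _, h1⟩,
      mem_image.2 ⟨x.2.2.2, mem_filter.2 ⟨mem_filter.2 ⟨mem_univ _, h3, ?_⟩, h5⟩, rfl⟩⟩
    exact ((mem_first hp hg code ω D s').1 h4).1
  have h2 := card_biUnion_le_mul
    (univ.filter fun x : Fin k × Fin k × Finset (Fin k) => x.1 ∈ x.2.2) coll
    (B := 2 * (1 / p) * (k * (g * m)) + σ * 1) fun x hx => by
      refine le_trans ?_ (hcollect (x.1, x.2.1, x.2.2, s) (mem_filter.1 hx).2)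
      exact_mod_cast card_image_le
  refine le_trans (by exact_mod_cast card_le_card hsub) (h2.trans ?_)
  exact mul_le_mul_of_nonneg_right (card_triples_le _) (by positivity)

theorem ratio_aux {m p g : ℕ} (hk : 1 ≤ k) (hg : 1 ≤ g) (hgp : g ^ k ≤ p) :
    1 / (p : ℝ) * (g * m) ≤ m / (g : ℝ) ^ (k - 1) := by
  have hg0 : (0 : ℝ) < g := by exact_mod_cast hg
  have hp : 0 < p := pow_card_le hg hgp (N := 0) (by omega)
  have hp0 : (0 : ℝ) < p := by exact_mod_cast hp
  rw [one_div_mul_eq_div, div_le_div_iff₀ hp0 (by positivity)]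
  have h1 : (g : ℝ) * g ^ (k - 1) ≤ p := by
    rw [← pow_succ', Nat.sub_add_cancel hk]
    exact_mod_cast hgp
  calc (g : ℝ) * m * g ^ (k - 1) = m * (g * g ^ (k - 1)) := by ring
    _ ≤ m * p := by gcongr

theorem first_bound_le {m p g : ℕ} (hk : 3 ≤ k) (hg : 1 ≤ g) (hgp : g ^ k ≤ p) (hpm : p ≤ m)
    {σ : ℝ} (hσ : 0 ≤ σ) :
    k * ((2 + σ) ^ (k - 1) * (m / (g : ℝ) ^ (k - 1))) + (k : ℝ) ^ 2 * 2 ^ k *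
        ((2 * (1 / p) * (k * (g * m)) + σ * ((k + 4 + σ) * (m / (g : ℝ) ^ (k - 1)))) +
          (2 * (1 / p) * ((k + 1) * m) + σ * 1)) ≤
      3 * (k : ℝ) ^ 2 * 2 ^ k * (k + 4 + σ) ^ k * (m / (g : ℝ) ^ (k - 1)) := by
  have h1 := ratio_aux (m := m) (by omega) hg hgp
  have h2 := div_le_ratio (m := m) hg hgp
  have h3 := one_le_ratio hg hgp hpm
  set L := (m : ℝ) / (g : ℝ) ^ (k - 1)
  set y : ℝ := k + 4 + σ with hy
  have hk3 : (3 : ℝ) ≤ k := by exact_mod_cast hk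
  have hy1 : 1 ≤ y := by linarith
  have hy2 : y ^ 2 ≤ y ^ k := pow_le_pow_right₀ hy1 (by omega)
  have a1 : 2 * (1 / (p : ℝ)) * (k * (g * m)) ≤ 2 * k * L := by
    calc _ = 2 * k * (1 / (p : ℝ) * (g * m)) := by ring
      _ ≤ _ := by gcongr
  have a2 : 2 * (1 / (p : ℝ)) * ((k + 1) * m) ≤ 2 * (k + 1) * L := by
    calc _ = 2 * ((k : ℝ) + 1) * (m / p) := by ring
      _ ≤ _ := by gcongr
  have a3 : σ * 1 ≤ σ * L := by gcongr
  have a4 : (2 + σ) ^ (k - 1) ≤ y ^ k := by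
    calc (2 + σ) ^ (k - 1) ≤ y ^ (k - 1) := by gcongr; linarith
      _ ≤ y ^ k := pow_le_pow_right₀ hy1 (by omega)
  have a5 : (k : ℝ) ≤ (k : ℝ) ^ 2 * 2 ^ k := by
    have : (1 : ℝ) ≤ 2 ^ k := one_le_pow₀ (by norm_num)
    nlinarith
  have a6 : 2 * k * L + σ * (y * L) + (2 * (k + 1) * L + σ * L) ≤ 2 * y ^ k * L := by
    have : 2 * k + σ * y + (2 * (k + 1) + σ) ≤ 2 * y ^ 2 := by nlinarith
    calc _ = (2 * k + σ * y + (2 * (k + 1) + σ)) * L := by ring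
      _ ≤ (2 * y ^ k) * L := by gcongr; linarith
  have hL0 : 0 ≤ L := by linarith
  calc _ ≤ (k : ℝ) ^ 2 * 2 ^ k * (y ^ k * L) + (k : ℝ) ^ 2 * 2 ^ k * (2 * y ^ k * L) := by
        have : k * ((2 + σ) ^ (k - 1) * L) ≤ (k : ℝ) ^ 2 * 2 ^ k * (y ^ k * L) := by
          gcongr
        have h6 : 2 * (1 / (p : ℝ)) * (k * (g * m)) + σ * (y * L) +
            (2 * (1 / (p : ℝ)) * ((k + 1) * m) + σ * 1) ≤ 2 * y ^ k * L := by linarith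
        have := mul_le_mul_of_nonneg_left h6 (by positivity : (0 : ℝ) ≤ (k : ℝ) ^ 2 * 2 ^ k)
        linarith
    _ = _ := by ring

theorem second_bound_le {m p g : ℕ} (hk : 3 ≤ k) (hg : 1 ≤ g) (hgp : g ^ k ≤ p) (hpm : p ≤ m)
    {σ : ℝ} (hσ : 0 ≤ σ) :
    (k : ℝ) ^ 2 * 2 ^ k * (2 * (1 / p) * (k * (g * m)) + σ * 1) ≤
      3 * (k : ℝ) ^ 2 * 2 ^ k * (k + 4 + σ) ^ k * (m / (g : ℝ) ^ (k - 1)) := by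
  refine le_trans ?_ (first_bound_le hk hg hgp hpm hσ)
  have h3 := one_le_ratio hg hgp hpm
  set L := (m : ℝ) / (g : ℝ) ^ (k - 1)
  have h : 2 * (1 / (p : ℝ)) * (k * (g * m)) + σ * 1 ≤
      2 * (1 / p) * (k * (g * m)) + σ * ((k + 4 + σ) * L) +
          (2 * (1 / p) * ((k + 1) * m) + σ * 1) := by
    have h1 : 0 ≤ σ * ((k + 4 + σ) * L) := by positivity
    have h2 : 0 ≤ 2 * (1 / (p : ℝ)) * ((k + 1) * m) := by positivity
    linarith
  have h4 : 0 ≤ k * ((2 + σ) ^ (k - 1) * L) := by positivity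
  have := mul_le_mul_of_nonneg_left h (by positivity : (0 : ℝ) ≤ (k : ℝ) ^ 2 * 2 ^ k)
  linarith

/-! ### Bits per message item. -/

/-- The number of bits for a fact or an item. -/
def itemBits (k n : ℕ) : ℕ := 4 * k * (Nat.clog 2 n + 1)

theorem card_item_le (k n : ℕ) : Fintype.card (Item k n) ≤ 2 ^ itemBits k n := by
  have h1 : k ≤ 2 ^ k := Nat.lt_two_pow_self.le
  have h2 : n ≤ 2 ^ Nat.clog 2 n := Nat.le_pow_clog (by norm_num) n
  simp only [Fintype.card_prod, Fintype.card_fin, Fintype.card_finset, Fintype.card_fun]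
  calc k * (k * (2 ^ k * n ^ k)) ≤ 2 ^ k * (2 ^ k * (2 ^ k * (2 ^ Nat.clog 2 n) ^ k)) := by gcongr
    _ = 2 ^ (k + k + k + Nat.clog 2 n * k) := by rw [← pow_mul]; ring
    _ ≤ 2 ^ itemBits k n := by
      refine Nat.pow_le_pow_right (by norm_num) ?_
      unfold itemBits
      nlinarith

theorem card_fact_le (k n : ℕ) :
    Fintype.card ((ConjunctiveQuery.loomisWhitney k).Fact n) ≤ 2 ^ itemBits k n := by
  rcases isEmpty_or_nonempty ((ConjunctiveQuery.loomisWhitney k).Fact n) with h | ⟨⟨j₀, u₀⟩⟩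
  · simp
  rcases isEmpty_or_nonempty (Fin n) with hn | ⟨⟨b⟩⟩
  · refine le_trans (Fintype.card_le_of_injective (fun f => f.1) ?_ :
      _ ≤ Fintype.card (Fin k)) ?_
    · rintro ⟨j, u⟩ ⟨j', u'⟩ e
      obtain rfl : j = j' := e
      congr
      funext i
      exact hn.elim (u i)
    · rw [Fintype.card_fin]
      refine Nat.lt_two_pow_self.le.trans (Nat.pow_le_pow_right (by norm_num) ?_)
      unfold itemBits
      nlinarith [Nat.zero_le (Nat.clog 2 n)]
  · refine (Fintype.card_le_of_injective (fun f => (f.1, f.1, ∅, extend f.1 f.2 b)) ?_).trans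
      (card_item_le k n)
    rintro ⟨j, u⟩ ⟨j', u'⟩ e
    simp only [Prod.mk.injEq] at e
    obtain ⟨rfl, -, -, e⟩ := e
    have := congrArg (res j) e
    simp only [res_extend] at this
    rw [this]

theorem itemBits_le {n : ℕ} (hn : 2 ≤ n) (k : ℕ) :
    (itemBits k n : ℝ) ≤ 12 * k * Real.logb 2 n := by
  have h1 : (1 : ℝ) ≤ Real.logb 2 n := by
    rw [Real.le_logb_iff_rpow_le (by norm_num) (by positivity)]
    simpa using (by exact_mod_cast hn : (2 : ℝ) ≤ n)
  have h2 : (Nat.clog 2 n : ℝ) ≤ Real.logb 2 n + 1 := by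
    have h := Real.natCeil_logb_natCast 2 n
    rw [← h]
    exact (Nat.ceil_lt_add_one (by push_cast; linarith)).le.trans_eq (by norm_num)
  unfold itemBits
  push_cast
  have hk : (0 : ℝ) ≤ k := by positivity
  nlinarith [mul_le_mul_of_nonneg_left h2 hk, mul_le_mul_of_nonneg_left h1 hk]

theorem maxLoad_le_of_good {D : DB k n} {m p g : ℕ} (hk : 3 ≤ k) (hD : ∀ j, #(D j) = m)
    (hp : 0 < p) (hg : 1 ≤ g) (hgp : g ^ k ≤ p) (hpm : p ≤ m) {code : (Fin k → Fin g) → Fin p}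
    (hcode : Function.Injective code) {σ : ℝ} (hσ : 0 ≤ σ) {w₀ : Fin k → Fin n}
    {ω : Coins k n p g} (hω : Good D m p g σ w₀ ω) {b Λ : ℕ}
    (h : ∀ N : ℕ, (∀ s, #((scheme k n m hp hg code).first ω D s) ≤ N) →
      (∀ s, ∑ s', #((scheme k n m hp hg code).sent ω D s' s) ≤ N) → Λ ≤ b * N) :
    (Λ : ℝ) ≤ b * (3 * (k : ℝ) ^ 2 * 2 ^ k * (k + 4 + σ) ^ k * (m / (g : ℝ) ^ (k - 1))) := by
  set X : ℝ := 3 * (k : ℝ) ^ 2 * 2 ^ k * (k + 4 + σ) ^ k * (m / (g : ℝ) ^ (k - 1)) with hX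
  have hX0 : 0 ≤ X := by positivity
  have h1 := h ⌊X⌋₊
    (fun s => Nat.le_floor ((card_first_le hD hp hg hgp hcode hσ hω s).trans
      (first_bound_le hk hg hgp hpm hσ)))
    (fun s => Nat.le_floor ((sum_card_sent_le hD hp hg hgp hσ hω s).trans
      (second_bound_le hk hg hgp hpm hσ)))
  calc (Λ : ℝ) ≤ b * (⌊X⌋₊ : ℝ) := by exact_mod_cast h1
    _ ≤ b * X := by gcongr; exact Nat.floor_le hX0

theorem two_le_of_two_le_card {D : DB k n} {j : Fin k} (h : 2 ≤ #(D j)) : 2 ≤ n := by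
  by_contra hn
  have : Subsingleton (Fin n) := Fin.subsingleton_iff_le_one.2 (by omega)
  have := card_le_one.2 fun u (_ : u ∈ D j) v _ => Subsingleton.elim u v
  omega

/-! ### Choice of the parameters and final estimates. -/

/-- The number of cells per coordinate. -/
noncomputable def share (k p : ℕ) : ℕ := ⌊(p : ℝ) ^ (1 / (k : ℝ))⌋₊

theorem share_spec {p : ℕ} (hk : 1 ≤ k) (hp : 1 ≤ p) :
    1 ≤ share k p ∧ share k p ^ k ≤ p ∧
      (p : ℝ) ^ (1 - 1 / (k : ℝ)) ≤ 2 ^ (k - 1) * (share k p : ℝ) ^ (k - 1) := by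
  have hk0 : (0 : ℝ) < k := by exact_mod_cast hk
  have hp1 : (1 : ℝ) ≤ p := by exact_mod_cast hp
  have hr1 : (1 : ℝ) ≤ (p : ℝ) ^ (1 / (k : ℝ)) := Real.one_le_rpow hp1 (by positivity)
  have h1 : 1 ≤ share k p := Nat.le_floor (by simpa using hr1)
  have h2 : (share k p : ℝ) ≤ (p : ℝ) ^ (1 / (k : ℝ)) := Nat.floor_le (by positivity)
  have h3 : (p : ℝ) ^ (1 / (k : ℝ)) < share k p + 1 := Nat.lt_floor_add_one _
  have h1' : (1 : ℝ) ≤ share k p := by exact_mod_cast h1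
  refine ⟨h1, ?_, ?_⟩
  · have : (share k p : ℝ) ^ k ≤ p := by
      calc (share k p : ℝ) ^ k ≤ ((p : ℝ) ^ (1 / (k : ℝ))) ^ k := by gcongr
        _ = p := by
          rw [← Real.rpow_natCast, ← Real.rpow_mul (by positivity), one_div_mul_cancel hk0.ne',
            Real.rpow_one]
    exact_mod_cast this
  · rw [← mul_pow]
    calc (p : ℝ) ^ (1 - 1 / (k : ℝ)) = ((p : ℝ) ^ (1 / (k : ℝ))) ^ (k - 1) := by
          rw [← Real.rpow_natCast, ← Real.rpow_mul (by positivity), Nat.cast_sub hk]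
          congr 1
          field_simp
          simp
      -- Rounding down a real number that is at least `1` loses at most a factor `2`.
      _ ≤ (2 * share k p) ^ (k - 1) := by gcongr; linarith

theorem exists_injective_code {p g : ℕ} (hgp : g ^ k ≤ p) :
    ∃ code : (Fin k → Fin g) → Fin p, Function.Injective code := by
  have : Nonempty ((Fin k → Fin g) ↪ Fin p) :=
    Function.Embedding.nonempty_of_card_le (by simpa using hgp)
  exact ⟨this.some, this.some.injective⟩

theorem unifProb_eq_natCard {Ω : Type*} [Fintype Ω] (E : Ω → Prop) :
    unifProb E = (Nat.card {ω // E ω} : ℝ) / Nat.card Ω := by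
  unfold unifProb
  rw [Nat.card_eq_fintype_card, Nat.card_eq_fintype_card, Fintype.card_subtype]

theorem load_bound_le {m p g : ℕ} (hk : 3 ≤ k) (hn : 2 ≤ n) (hp : 1 ≤ p)
    (hg : 1 ≤ g) (hgp : (p : ℝ) ^ (1 - 1 / (k : ℝ)) ≤ 2 ^ (k - 1) * (g : ℝ) ^ (k - 1)) {A : ℝ}
    {e : ℕ} (hA : 0 ≤ A) :
    itemBits k n * (3 * (k : ℝ) ^ 2 * 2 ^ k * (k + 4 + (A + e * Real.log p)) ^ k *
      (m / (g : ℝ) ^ (k - 1))) ≤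
    (12 * k * (3 * (k : ℝ) ^ 2 * 2 ^ k * (k + 4 + A + e) ^ k * 2 ^ (k - 1))) *
      (1 + Real.log p) ^ k * (relationBits (k - 1) m n / (p : ℝ) ^ (1 - 1 / (k : ℝ))) := by
  have hg0 : (0 : ℝ) < g := by exact_mod_cast hg
  have hp0 : (0 : ℝ) < p := by exact_mod_cast hp
  have hlog : 0 ≤ Real.log p := Real.log_nonneg (by exact_mod_cast hp)
  have hl : 0 ≤ Real.logb 2 n := Real.logb_nonneg (by norm_num) (by exact_mod_cast (by omega))
  set P := (p : ℝ) ^ (1 - 1 / (k : ℝ)) with hP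
  have hP0 : 0 < P := by positivity
  have h1 : k + 4 + (A + e * Real.log p) ≤ (k + 4 + A + e) * (1 + Real.log p) := by
    have : (0 : ℝ) ≤ e := by positivity
    have hk0 : (0 : ℝ) ≤ k := by positivity
    have : 0 ≤ (k + 4 + A) * Real.log p := by positivity
    nlinarith
  have h2 : (m : ℝ) / (g : ℝ) ^ (k - 1) ≤ 2 ^ (k - 1) * (m / P) := by
    rw [← mul_div_assoc, div_le_div_iff₀ (by positivity) hP0]
    calc (m : ℝ) * P ≤ m * (2 ^ (k - 1) * (g : ℝ) ^ (k - 1)) := by gcongr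
      _ = _ := by ring
  have h3 : (m : ℝ) * Real.logb 2 n ≤ relationBits (k - 1) m n := by
    unfold relationBits
    have h4 : (1 : ℝ) ≤ ((k - 1 : ℕ) : ℝ) := by exact_mod_cast (by omega : 1 ≤ k - 1)
    calc (m : ℝ) * Real.logb 2 n = 1 * m * Real.logb 2 n := by ring
      _ ≤ _ := by gcongr
  calc _ ≤ 12 * k * Real.logb 2 n * (3 * (k : ℝ) ^ 2 * 2 ^ k *
        ((k + 4 + A + e) * (1 + Real.log p)) ^ k * (2 ^ (k - 1) * (m / P))) := by
        gcongr
        exact itemBits_le hn k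
    _ = (12 * k * (3 * (k : ℝ) ^ 2 * 2 ^ k * (k + 4 + A + e) ^ k * 2 ^ (k - 1))) *
      (1 + Real.log p) ^ k * (m * Real.logb 2 n / P) := by rw [mul_pow]; ring
    _ ≤ _ := by gcongr

/-- This value of `σ` cancels the constant and the factor `p^2` of the union bound and leaves
`p^(-a)`. -/
theorem failure_bound {p a : ℕ} (hk : 1 ≤ k) (hp : 1 ≤ p) :
    6 * (k : ℝ) ^ 2 * 4 ^ k * p ^ 2 *
      Real.exp (-(Real.log (6 * (k : ℝ) ^ 2 * 4 ^ k) + (a + 2 : ℕ) * Real.log p)) ≤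
      1 / (p : ℝ) ^ a := by
  have hk0 : (0 : ℝ) < k := by exact_mod_cast hk
  have hp0 : (0 : ℝ) < p := by exact_mod_cast hp
  rw [← Real.log_pow, ← Real.log_mul (by positivity) (by positivity), Real.exp_neg,
    Real.exp_log (by positivity)]
  refine le_of_eq ?_
  field_simp
  ring

end LoomisWhitney

/-! ### The main theorem. -/

theorem mainTheorem7 (k : ℕ) (hk : 3 ≤ k) :
    ∃ c : ℕ, ∀ a : ℕ, ∃ C : ℝ, 0 < C ∧
      ∀ p n m : ℕ, 1 ≤ p → p ≤ m →
        ∃ A : MPCAlgorithm (ConjunctiveQuery.loomisWhitney k) n p,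
          A.ComputesWithLoad m 2
            (C * (1 + Real.log (p : ℝ)) ^ c *
              (relationBits (k - 1) m n / (p : ℝ) ^ (1 - 1 / (k : ℝ))))
            (1 / (p : ℝ) ^ a) := by
  have hk1 : (1 : ℝ) ≤ k := by exact_mod_cast (by omega : 1 ≤ k)
  set A₀ : ℝ := Real.log (6 * (k : ℝ) ^ 2 * 4 ^ k) with hA₀
  have hA₀0 : 0 ≤ A₀ := by
    refine Real.log_nonneg ?_
    have h4 : (1 : ℝ) ≤ 4 ^ k := one_le_pow₀ (by norm_num)
    have hk2 : (1 : ℝ) ≤ (k : ℝ) ^ 2 := one_le_pow₀ hk1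
    nlinarith
  refine ⟨k, fun a => ⟨12 * k * (3 * (k : ℝ) ^ 2 * 2 ^ k * (k + 4 + A₀ + (a + 2 : ℕ)) ^ k *
    2 ^ (k - 1)), by positivity, fun p n m hp hpm => ?_⟩⟩
  obtain ⟨hg, hgp, hgP⟩ := LoomisWhitney.share_spec (k := k) (by omega) hp
  set g := LoomisWhitney.share k p
  obtain ⟨code, hcode⟩ := LoomisWhitney.exists_injective_code hgp
  have hbits : 1 ≤ LoomisWhitney.itemBits k n := by
    unfold LoomisWhitney.itemBits
    exact Nat.mul_pos (by omega) (by omega)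
  obtain ⟨M, e, hM⟩ := (LoomisWhitney.scheme k n m hp hg code).exists_algorithm hbits
    (LoomisWhitney.card_fact_le k n) (LoomisWhitney.card_item_le k n)
  refine ⟨M, fun D place hD _ => ⟨fun ω => (hM D place ω).1.trans
    (LoomisWhitney.scheme_correct (by omega) hD hp hg hgp code (e ω)), ?_⟩⟩
  -- For `p = 1` the allowed failure probability is `1`. Treating it apart matters because `n ≥ 2`,
  -- and with it a positive `logb 2 n`, follows only from `m ≥ p ≥ 2`.
  rcases hp.eq_or_lt with rfl | hp2
  · simp only [Nat.cast_one, one_pow, div_one, sub_self]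
    unfold MPCAlgorithm.probLoadLe
    positivity
  have hn : 2 ≤ n := LoomisWhitney.two_le_of_two_le_card (D := D) (j := ⟨0, by omega⟩)
    (by rw [hD]; omega)
  have hlog : 0 ≤ Real.log p := Real.log_nonneg (by exact_mod_cast hp)
  set σ : ℝ := A₀ + (a + 2 : ℕ) * Real.log p with hσ
  have hσ0 : 0 ≤ σ := by positivity
  let w₀ : Fin k → Fin n := fun _ => ⟨0, by omega⟩
  have hbad := (LoomisWhitney.unifProb_not_good_le (by omega) hD (by omega) hg hgp hpm hσ0 w₀).trans
    (LoomisWhitney.failure_bound (a := a) (by omega) hp)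
  let e' : M.Seed ≃ LoomisWhitney.Coins k n p g := e
  have hgood : 1 - 1 / (p : ℝ) ^ a ≤ unifProb (fun ω : M.Seed =>
      LoomisWhitney.Good D m p g σ w₀ (e' ω)) := by
    have : Nonempty (LoomisWhitney.Coins k n p g) :=
      (LoomisWhitney.scheme k n m hp hg code).seedNonempty
    have h1 := unifProb_not fun ω => LoomisWhitney.Good D m p g σ w₀ ω
    have h2 := unifProb_equiv e' fun ω => LoomisWhitney.Good D m p g σ w₀ ω
    rw [h2]
    have h3 := hbad
    rw [h1] at h3
    linarith
  refine hgood.trans ?_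
  unfold MPCAlgorithm.probLoadLe
  rw [← LoomisWhitney.unifProb_eq_natCard]
  refine unifProb_mono fun ω hω => ?_
  exact (LoomisWhitney.maxLoad_le_of_good hk hD hp hg hgp hpm hcode hσ0 hω (hM D place ω).2).trans
    (LoomisWhitney.load_bound_le hk hn hp hg hgP hA₀0)
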